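/- For $\theta\in(-1,1)$ let $(X_1(t),X_2(t))_{t\ge 0}$ be a two-dimensional Brownian motion (a continuous centered Gaussian process starting at the origin with stationary and independent increments), and let $(Y_1,Y_2)$ be a normal vector independent of this process and with the same law as $(X_1(1),X_2(1))$, where the common covariance matrix $\Sigma$ satisfies $$\Sigma^{-1}=\begin{pmatrix}1&\theta\\ \theta&1\end{pmatrix}.$$ For $w_1\in[0,1]$ and $w_2=1-w_1$ put $V=w_1X_1(Y_1^{-2})+w_2X_2(Y_2^{-2})$. (1) For all $w_1\in[0,1]$ and $\theta\in(-1,1)$ the random variable $V$ has the density $$g_{\theta}(v)=\int_{\mathbb R^2}h_{y_1,y_2}(v)\,\frac{\sqrt{1-\theta^2}}{2\pi}\,e^{-(y_1^2+2\theta y_1y_2+y_2^2)/2}\,dy_1\,dy_2,$$ where $h_{y_1,y_2}$ is the density of the centered normal law with variance $$\frac{w_1^2}{y_1^2(1-\theta^2)}-\frac{2w_1w_2\theta}{\max(y_1^2,y_2^2)(1-\theta^2)}+\frac{w_2^2}{y_2^2(1-\theta^2)},$$ and $\lim_{v\to\infty}v^2g_\theta(v)=1/\pi$. (2) For all $w_1\in(0,1)$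 the function $\theta\mapsto g_\theta(0)$ is differentiable at $\theta=0$, with $$\frac{\partial g_\theta(0)}{\partial\theta}\bigg|_{\theta=0}=\int_0^1\frac{w_1w_2x^3}{\pi(w_1^2+w_2^2x^2)^{3/2}(x^2+1)^{3/2}}\,dx+\int_0^1\frac{w_1w_2x^3}{\pi(w_2^2+w_1^2x^2)^{3/2}(x^2+1)^{3/2}}\,dx>0.$$ (3) For all $w_1\in(0,1)$ there is $\varepsilon\in(0,1]$ such that for every $\theta$ with $0<|\theta|<\varepsilon$ the random variable $V$ does not have a Cauchy distribution: for no $\sigma>0$ is $\sigma/(\pi(x^2+\sigma^2))$, $x\in\mathbb R$, a density of $V$. In particular $V$ is not standard Cauchy. -/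

import Mathlib

open MeasureTheory ProbabilityTheory Filter Topology Set
open scoped NNReal

universe u

noncomputable section

namespace StoppedBrownian

/-- An `ℝⁿ`-valued Brownian motion: a (almost surely) continuous centered Gaussian process that
starts at the origin and has stationary and independent increments. Its components may be
correlated. -/
structure IsBrownianMotion {Ω : Type*} [MeasurableSpace Ω] {n : ℕ}
    (X : ℝ≥0 → Ω → (Fin n → ℝ)) (P : Measure Ω) : Prop where
  gaussian : IsGaussianProcess X P
  centered : ∀ t i, ∫ ω, X t ω i ∂P = 0
  start : ∀ᵐ ω ∂P, X 0 ω = 0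
  continuous_paths : ∀ᵐ ω ∂P, Continuous fun t => X t ω
  indep_increments : HasIndepIncrements X P
  stationary_increments : ∀ s t : ℝ≥0,
    IdentDistrib (fun ω => X (s + t) ω - X s ω) (fun ω => X t ω - X 0 ω) P P

/-- The covariance matrix of a random vector. -/
def covMatrix {Ω : Type*} [MeasurableSpace Ω] {n : ℕ} (Z : Ω → (Fin n → ℝ)) (P : Measure Ω) :
    Matrix (Fin n) (Fin n) ℝ :=
  Matrix.of fun i j => cov[fun ω => Z ω i, fun ω => Z ω j; P]

/-- `X` is a two-dimensional Brownian motion, `Y` is a random vector independent of the whole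
process `X`, with the law of `X(1)`, and the inverse of their common covariance matrix has
diagonal entries `1` and off-diagonal entries `θ`. -/
structure IsModel {Ω : Type*} [MeasurableSpace Ω] (θ : ℝ)
    (X : ℝ≥0 → Ω → (Fin 2 → ℝ)) (Y : Ω → (Fin 2 → ℝ)) (P : Measure Ω) : Prop where
  brownian : IsBrownianMotion X P
  same_law : IdentDistrib Y (X 1) P P
  indep : IndepFun (fun ω t => X t ω) Y P
  inv_cov : (covMatrix (X 1) P)⁻¹ = !![1, θ; θ, 1]

/-- The sum `∑ j, w_j X_j(Y_j⁻²)` of randomly stopped components of the process `X`. -/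
def stoppedSum {Ω : Type*} {n : ℕ} (w : Fin n → ℝ)
    (X : ℝ≥0 → Ω → (Fin n → ℝ)) (Y : Ω → (Fin n → ℝ)) (ω : Ω) : ℝ :=
  ∑ j, w j * X (Real.toNNReal ((Y ω j ^ 2)⁻¹)) ω j

/-- The density of a centered normal vector in the plane whose inverse covariance matrix has
diagonal entries `1` and off-diagonal entries `θ`. -/
def normalDensity (θ : ℝ) (y : ℝ × ℝ) : ℝ :=
  Real.sqrt (1 - θ ^ 2) / (2 * Real.pi) *
    Real.exp (-(y.1 ^ 2 + 2 * θ * y.1 * y.2 + y.2 ^ 2) / 2)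

/-- The conditional variance of `w₁ X₁(y₁⁻²) + w₂ X₂(y₂⁻²)`. -/
def mixVariance (w₁ w₂ θ : ℝ) (y : ℝ × ℝ) : ℝ :=
  w₁ ^ 2 / (y.1 ^ 2 * (1 - θ ^ 2))
    - 2 * w₁ * w₂ * θ / (max (y.1 ^ 2) (y.2 ^ 2) * (1 - θ ^ 2))
    + w₂ ^ 2 / (y.2 ^ 2 * (1 - θ ^ 2))

/-- The Gaussian mixture density
`g(v) = ∫ h_y(v) f(y) dy`, with `h_y` the centered normal density of variance
`mixVariance w₁ w₂ θ y` and `f = normalDensity θ`. -/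
def mixDensity (w₁ w₂ θ v : ℝ) : ℝ :=
  ∫ y : ℝ × ℝ, gaussianPDFReal 0 (Real.toNNReal (mixVariance w₁ w₂ θ y)) v * normalDensity θ y

/-- `∫₀¹ a b x³ / (π (a² + b² x²)^{3/2} (x² + 1)^{3/2}) dx`. -/
def slopeIntegral (a b : ℝ) : ℝ :=
  ∫ x in (0 : ℝ)..1, a * b * x ^ 3 /
    (Real.pi * (a ^ 2 + b ^ 2 * x ^ 2) ^ (3 / 2 : ℝ) * (x ^ 2 + 1) ^ (3 / 2 : ℝ))

end StoppedBrownian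

end

/-! Write a = w₁, b = w₂. Brownian covariances are `min s t` times the covariance at time 1.
Conditionally on Y = y, V is therefore centered normal with variance `mixVariance`, the maximum
there being the reciprocal of the smaller of the times y₁⁻², y₂⁻². Thus V is a normal mixture with
density `mixDensity`. To avoid conditioning on a random time, times are rounded down to multiples of
1/N. Only countably many coordinates of X then matter, Fubini gives the characteristic function
(`IsModel.integral_exp_gridSum`), and path continuity gives the limit
(`IsModel.charFun_stoppedSum`). It agrees with that of the mixture (`charFun_mixDensity`).

The density is analysed through the ratio x = y₁/y₂. On |y₁| < |y₂| the integral over y₂ is a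
Gaussian second moment, which leaves an integral over |x| ≤ 1 (`halfDensity`). The other half is the
same with a and b exchanged (`mixDensity_eq`). Scaling x = u/v shows that v² times the first half
tends to a/π, so the tail constant is (a + b)/π = 1/π.

A Cauchy density of scale σ has tail constant σ/π. If V is Cauchy, then σ = 1 and, as the mixture
density is continuous, its value at 0 is 1/π. At θ = 0 that value is attained
(`halfDensity_add_zero`), but the θ-derivative there is strictly positive
(`hasDerivAt_mixDensity_zero`, `slopeIntegral_pos`). Hence the value differs from 1/π for small θ ≠
0. -/

namespace StoppedBrownian

/-! ### Covariances of Brownian motion at rational times -/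

section BrownianCovariance

variable {Ω : Type*} [MeasurableSpace Ω] {P : Measure Ω} {n : ℕ} {X : ℝ≥0 → Ω → (Fin n → ℝ)}

lemma IsBrownianMotion.isProbabilityMeasure (hX : IsBrownianMotion X P) :
    IsProbabilityMeasure P :=
  hX.gaussian.isProbabilityMeasure

lemma IsBrownianMotion.hasGaussianLaw_coord (hX : IsBrownianMotion X P) (t : ℝ≥0) (i : Fin n) :
    HasGaussianLaw (fun ω => X t ω i) P :=
  (hX.gaussian.hasGaussianLaw_eval t).eval i

lemma IsBrownianMotion.memLp_coord (hX : IsBrownianMotion X P) (t : ℝ≥0) (i : Fin n) :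
    MemLp (fun ω => X t ω i) 2 P :=
  (hX.hasGaussianLaw_coord t i).memLp_two

lemma IsBrownianMotion.cov_increment (hX : IsBrownianMotion X P) (s t : ℝ≥0) (i j : Fin n) :
    cov[fun ω => X (s + t) ω i - X s ω i, fun ω => X (s + t) ω j - X s ω j; P]
      = cov[fun ω => X t ω i, fun ω => X t ω j; P] := by
  have h := hX.stationary_increments s t
  have h0 : (fun ω => X t ω - X 0 ω) =ᵐ[P] X t := by
    filter_upwards [hX.start] with ω hω using by simp [hω]
  have hmap : P.map (fun ω => X (s + t) ω - X s ω) = P.map (X t) := by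
    rw [h.map_eq, Measure.map_congr h0]
  have key : ∀ Z : Ω → (Fin n → ℝ), AEMeasurable Z P →
      cov[fun ω => Z ω i, fun ω => Z ω j; P]
        = cov[fun z => z i, fun z => z j; P.map Z] := fun Z hZ => by
    rw [covariance_map (measurable_pi_apply i).aestronglyMeasurable
      (measurable_pi_apply j).aestronglyMeasurable hZ]
    rfl
  have h1 := key (fun ω => X (s + t) ω - X s ω) h.aemeasurable_fst
  have h2 := key (X t) (hX.gaussian.aemeasurable t)
  rw [hmap] at h1
  exact h1.trans h2.symm

/-- The increment from s to t is independent of X(s), which is itself an increment because the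
process starts at 0. -/
lemma IsBrownianMotion.cov_of_le (hX : IsBrownianMotion X P) {s t : ℝ≥0} (hst : s ≤ t)
    (i j : Fin n) :
    cov[fun ω => X s ω i, fun ω => X t ω j; P]
      = cov[fun ω => X s ω i, fun ω => X s ω j; P] := by
  have := hX.isProbabilityMeasure
  have hind := hX.indep_increments.indepFun_eval_sub (bot_le : (0 : ℝ≥0) ≤ s) hst hX.start
  have hind' : IndepFun (fun ω => X s ω i) (fun ω => X t ω j - X s ω j) P :=
    hind.comp (φ := fun z : Fin n → ℝ => z i) (ψ := fun z : Fin n → ℝ => z j)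
      (measurable_pi_apply i) (measurable_pi_apply j)
  have h0 := hind'.covariance_eq_zero (hX.memLp_coord s i)
    ((hX.memLp_coord t j).sub (hX.memLp_coord s j))
  rw [covariance_fun_sub_right (hX.memLp_coord s i) (hX.memLp_coord t j)
    (hX.memLp_coord s j)] at h0
  linarith

lemma IsBrownianMotion.cov_add (hX : IsBrownianMotion X P) (s t : ℝ≥0) (i j : Fin n) :
    cov[fun ω => X (s + t) ω i, fun ω => X (s + t) ω j; P]
      = cov[fun ω => X s ω i, fun ω => X s ω j; P]
        + cov[fun ω => X t ω i, fun ω => X t ω j; P] := by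
  have := hX.isProbabilityMeasure
  have h := hX.cov_increment s t i j
  rw [covariance_fun_sub_fun_sub (hX.memLp_coord _ i) (hX.memLp_coord _ i) (hX.memLp_coord _ j)
    (hX.memLp_coord _ j), hX.cov_of_le le_self_add, covariance_comm (fun ω => X (s + t) ω i)
      (fun ω => X s ω j),
    hX.cov_of_le le_self_add, covariance_comm (fun ω => X s ω j) (fun ω => X s ω i)] at h
  linarith

lemma IsBrownianMotion.cov_nsmul (hX : IsBrownianMotion X P) (m : ℕ) (t : ℝ≥0) (i j : Fin n) :
    cov[fun ω => X (m * t) ω i, fun ω => X (m * t) ω j; P]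
      = m * cov[fun ω => X t ω i, fun ω => X t ω j; P] := by
  induction m with
  | zero =>
    have h := hX.cov_add 0 0 i j
    simp only [add_zero] at h
    simp only [Nat.cast_zero, zero_mul]
    linarith
  | succ m ih =>
    have : ((m + 1 : ℕ) : ℝ≥0) * t = m * t + t := by push_cast; ring
    rw [this, hX.cov_add, ih]
    push_cast
    ring

/-- Same-time covariance is additive in time, hence linear along multiples of 1/N. Since 1 is also
such a multiple, the slope is the covariance at time 1. Working on the grid spares any regularity
argument in t. -/
lemma IsBrownianMotion.cov_rat (hX : IsBrownianMotion X P) {N : ℕ} (hN : N ≠ 0) (m k : ℕ)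
    (i j : Fin n) :
    cov[fun ω => X (m / N) ω i, fun ω => X (k / N) ω j; P]
      = min (m / N : ℝ) (k / N) * covMatrix (X 1) P i j := by
  have hN' : (N : ℝ) ≠ 0 := by exact_mod_cast hN
  have hN0 : (N : ℝ≥0) ≠ 0 := by exact_mod_cast hN
  have hsame : ∀ (m : ℕ) (i j : Fin n), cov[fun ω => X (m / N) ω i, fun ω => X (m / N) ω j; P]
      = (m / N : ℝ) * covMatrix (X 1) P i j := fun m i j => by
    have h1 := hX.cov_nsmul m (1 / N) i j
    have h2 := hX.cov_nsmul N (1 / N) i j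
    rw [mul_one_div, div_self hN0] at h2
    rw [mul_one_div] at h1
    rw [h1, covMatrix, Matrix.of_apply, h2]
    field_simp
  have hsymm : ∀ i j : Fin n, covMatrix (X 1) P i j = covMatrix (X 1) P j i := fun i j =>
    covariance_comm _ _
  rcases le_total m k with h | h
  · have h' : (m / N : ℝ≥0) ≤ k / N := by gcongr
    have h'' : (m / N : ℝ) ≤ k / N := by gcongr
    rw [hX.cov_of_le h', hsame, min_eq_left h'']
  · have h' : (k / N : ℝ≥0) ≤ m / N := by gcongr
    have h'' : (k / N : ℝ) ≤ m / N := by gcongr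
    rw [covariance_comm, hX.cov_of_le h', hsame, min_eq_right h'', hsymm]

end BrownianCovariance

lemma IsBrownianMotion.map_linearCombination {Ω : Type*} [MeasurableSpace Ω] {P : Measure Ω}
    {X : ℝ≥0 → Ω → (Fin 2 → ℝ)} (hX : IsBrownianMotion X P) {N : ℕ} (hN : N ≠ 0) (m k : ℕ)
    (a b : ℝ) :
    P.map (fun ω => a * X (m / N) ω 0 + b * X (k / N) ω 1) =
      gaussianReal 0 (Real.toNNReal (a ^ 2 * (m / N) * covMatrix (X 1) P 0 0
        + 2 * a * b * min (m / N : ℝ) (k / N) * covMatrix (X 1) P 0 1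
        + b ^ 2 * (k / N) * covMatrix (X 1) P 1 1)) := by
  have := hX.isProbabilityMeasure
  have hg : HasGaussianLaw (fun ω => a * X (m / N) ω 0 + b * X (k / N) ω 1) P := by
    have h := (hX.gaussian.hasGaussianLaw_prodMk (s := (m / N : ℝ≥0)) (t := (k / N : ℝ≥0))).map_fun
      (a • (ContinuousLinearMap.proj (R := ℝ) (φ := fun _ : Fin 2 => ℝ) 0).comp
        (ContinuousLinearMap.fst ℝ _ _) +
      b • (ContinuousLinearMap.proj (R := ℝ) (φ := fun _ : Fin 2 => ℝ) 1).comp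
        (ContinuousLinearMap.snd ℝ _ _))
    simpa using h
  have m1 := (hX.memLp_coord (m / N) 0).const_mul a
  have m2 := (hX.memLp_coord (k / N) 1).const_mul b
  have hmean : ∫ ω, a * X (m / N) ω 0 + b * X (k / N) ω 1 ∂P = 0 := by
    rw [integral_add (m1.integrable one_le_two) (m2.integrable one_le_two), integral_const_mul,
      integral_const_mul, hX.centered, hX.centered]
    simp
  rw [hg.map_eq_gaussianReal, hmean]
  congr 2
  rw [variance_fun_add m1 m2, variance_const_mul, variance_const_mul, covariance_const_mul_left,
    covariance_const_mul_right, ← covariance_self (hX.hasGaussianLaw_coord _ _).aemeasurable,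
    ← covariance_self (hX.hasGaussianLaw_coord _ _).aemeasurable, hX.cov_rat hN, hX.cov_rat hN,
    hX.cov_rat hN, min_self, min_self]
  ring

/-! ### The normal law of Y -/

lemma IsModel.covMatrix_eq {Ω : Type*} [MeasurableSpace Ω] {P : Measure Ω} {θ : ℝ}
    {X : ℝ≥0 → Ω → (Fin 2 → ℝ)} {Y : Ω → (Fin 2 → ℝ)} (h : IsModel θ X Y P)
    (hθ : θ ∈ Ioo (-1 : ℝ) 1) :
    covMatrix (X 1) P =
      !![1 / (1 - θ ^ 2), -θ / (1 - θ ^ 2); -θ / (1 - θ ^ 2), 1 / (1 - θ ^ 2)] := by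
  have hd : 1 - θ ^ 2 ≠ 0 := by nlinarith [hθ.1, hθ.2]
  have hu : IsUnit (covMatrix (X 1) P).det := by
    -- The inverse of a singular matrix is 0 by convention, which the diagonal entry 1 excludes.
    by_contra hn
    have h1 := h.inv_cov
    rw [Matrix.nonsing_inv_apply_not_isUnit _ hn] at h1
    simpa using congrFun (congrFun h1 0) 0
  have h2 : (covMatrix (X 1) P) = (!![1, θ; θ, 1] : Matrix (Fin 2) (Fin 2) ℝ)⁻¹ := by
    rw [← h.inv_cov, Matrix.nonsing_inv_nonsing_inv _ hu]
  rw [h2]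
  apply Matrix.inv_eq_right_inv
  ext i j
  fin_cases i <;> fin_cases j <;> simp [Matrix.mul_apply, Fin.sum_univ_two] <;> field_simp <;> ring

/-- The centered normal law in the plane with density `normalDensity θ`. -/
noncomputable def planeNormal (θ : ℝ) : Measure (ℝ × ℝ) :=
  volume.withDensity fun y => ENNReal.ofReal (normalDensity θ y)

lemma one_sub_sq_pos {θ : ℝ} (hθ : θ ∈ Ioo (-1 : ℝ) 1) : 0 < 1 - θ ^ 2 := by
  nlinarith [hθ.1, hθ.2]

lemma normalDensity_nonneg (θ : ℝ) (y : ℝ × ℝ) : 0 ≤ normalDensity θ y := by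
  unfold normalDensity
  positivity

lemma measurable_normalDensity (θ : ℝ) : Measurable (normalDensity θ) := by
  unfold normalDensity
  fun_prop

/-- Completing the square: x² + 2θxy + y² = (x + θy)² + (1 - θ²)y². -/
lemma gaussianPDFReal_mul_gaussianPDFReal {θ : ℝ} (hθ : θ ∈ Ioo (-1 : ℝ) 1) (x y : ℝ) :
    gaussianPDFReal 0 1 (x + θ * y) * gaussianPDFReal 0 (Real.toNNReal (1 / (1 - θ ^ 2))) y
      = normalDensity θ (x, y) := by
  have hd := one_sub_sq_pos hθ
  rw [gaussianPDFReal, gaussianPDFReal, normalDensity, Real.coe_toNNReal _ (by positivity)]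
  rw [mul_mul_mul_comm, ← Real.exp_add]
  congr 1
  · have h2 : Real.sqrt (2 * Real.pi * (1 / (1 - θ ^ 2)))
        = Real.sqrt (2 * Real.pi) / Real.sqrt (1 - θ ^ 2) := by
      rw [mul_one_div, Real.sqrt_div (by positivity)]
    have h3 := Real.mul_self_sqrt (show 0 ≤ 2 * Real.pi by positivity)
    have h4 : 0 < Real.sqrt (2 * Real.pi) := by positivity
    have h5 : 0 < Real.sqrt (1 - θ ^ 2) := by positivity
    rw [h2, NNReal.coe_one, mul_one]
    nth_rewrite 3 [← h3]
    field_simp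
  · congr 1
    simp only [NNReal.coe_one]
    field_simp
    ring

/-- The map is a shear, of determinant 1, so only a translation in the first variable is needed.
This also yields that `normalDensity` has total mass 1. -/
lemma map_prod_gaussianReal {θ : ℝ} (hθ : θ ∈ Ioo (-1 : ℝ) 1) :
    ((gaussianReal 0 1).prod (gaussianReal 0 (Real.toNNReal (1 / (1 - θ ^ 2))))).map
      (fun p => (p.1 - θ * p.2, p.2)) = planeNormal θ := by
  have hd := one_sub_sq_pos hθ
  have hτ : Real.toNNReal (1 / (1 - θ ^ 2)) ≠ 0 := by
    rw [Ne, Real.toNNReal_eq_zero, not_le]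
    positivity
  have hm := (measurable_normalDensity θ).ennreal_ofReal
  ext s hs
  rw [Measure.map_apply (by fun_prop) hs, gaussianReal_of_var_ne_zero _ one_ne_zero,
    gaussianReal_of_var_ne_zero _ hτ,
    prod_withDensity (measurable_gaussianPDF _ _) (measurable_gaussianPDF _ _),
    withDensity_apply _ (hs.preimage (by fun_prop)), planeNormal, withDensity_apply _ hs,
    ← lintegral_indicator (hs.preimage (by fun_prop)), ← lintegral_indicator hs,
    Measure.volume_eq_prod, lintegral_prod_symm, lintegral_prod_symm]
  · refine lintegral_congr fun y => ?_
    rw [← lintegral_add_right_eq_self _ (θ * y)]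
    refine lintegral_congr fun x => ?_
    simp only [indicator, gaussianPDF]
    rw [← ENNReal.ofReal_mul (gaussianPDFReal_nonneg _ _ _),
      gaussianPDFReal_mul_gaussianPDFReal hθ]
    have hiff : (x + θ * y, y) ∈ (fun p : ℝ × ℝ => (p.1 - θ * p.2, p.2)) ⁻¹' s ↔ (x, y) ∈ s := by
      rw [mem_preimage, add_sub_cancel_right]
    by_cases hxy : (x, y) ∈ s
    · rw [if_pos hxy, if_pos (hiff.2 hxy)]
    · rw [if_neg hxy, if_neg (mt hiff.1 hxy)]
  · exact (hm.indicator hs).aemeasurable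
  · refine (Measurable.indicator ?_ (hs.preimage (by fun_prop))).aemeasurable
    exact ((measurable_gaussianPDF _ _).comp measurable_fst).mul
      ((measurable_gaussianPDF _ _).comp measurable_snd)

lemma isProbabilityMeasure_planeNormal {θ : ℝ} (hθ : θ ∈ Ioo (-1 : ℝ) 1) :
    IsProbabilityMeasure (planeNormal θ) := by
  rw [← map_prod_gaussianReal hθ]
  exact Measure.isProbabilityMeasure_map (by fun_prop)

lemma ae_volume_ne_zero : ∀ᵐ y : ℝ × ℝ, y.1 ≠ 0 ∧ y.2 ≠ 0 := by
  have h0 : ∀ᵐ x : ℝ, x ≠ 0 := by simp [ae_iff]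
  exact (Measure.quasiMeasurePreserving_fst.ae h0).and (Measure.quasiMeasurePreserving_snd.ae h0)

lemma ae_planeNormal_ne_zero (θ : ℝ) : ∀ᵐ y ∂planeNormal θ, y.1 ≠ 0 ∧ y.2 ≠ 0 :=
  (withDensity_absolutelyContinuous _ _).ae_le ae_volume_ne_zero

/-! ### The characteristic function of V, by discretizing time -/

section Model

variable {Ω : Type*} [MeasurableSpace Ω] {P : Measure Ω} {θ : ℝ}
  {X : ℝ≥0 → Ω → (Fin 2 → ℝ)} {Y : Ω → (Fin 2 → ℝ)}

/-- X₁(1) + θX₂(1) is uncorrelated with X₂(1), hence independent of it by joint normality. Their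
variances are 1 and 1/(1 - θ²), and the shear of `map_prod_gaussianReal` recovers the pair. -/
lemma IsModel.map_pair (h : IsModel θ X Y P) (hθ : θ ∈ Ioo (-1 : ℝ) 1) :
    P.map (fun ω => (Y ω 0, Y ω 1)) = planeNormal θ := by
  have hB := h.brownian
  have := hB.isProbabilityMeasure
  have hX1 := hB.gaussian.aemeasurable 1
  have hpair : P.map (fun ω => (Y ω 0, Y ω 1)) = P.map (fun ω => (X 1 ω 0, X 1 ω 1)) := by
    have hf : Measurable fun z : Fin 2 → ℝ => (z 0, z 1) := by fun_prop
    have h1 := AEMeasurable.map_map_of_aemeasurable hf.aemeasurable h.same_law.aemeasurable_fst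
    have h2 := AEMeasurable.map_map_of_aemeasurable hf.aemeasurable hX1
    rw [h.same_law.map_eq] at h1
    exact h1.symm.trans h2
  have hcov := h.covMatrix_eq hθ
  have c00 : cov[fun ω => X 1 ω 0, fun ω => X 1 ω 0; P] = 1 / (1 - θ ^ 2) := by
    simpa [covMatrix] using congrFun (congrFun hcov 0) 0
  have c01 : cov[fun ω => X 1 ω 0, fun ω => X 1 ω 1; P] = -θ / (1 - θ ^ 2) := by
    simpa [covMatrix] using congrFun (congrFun hcov 0) 1
  have c11 : cov[fun ω => X 1 ω 1, fun ω => X 1 ω 1; P] = 1 / (1 - θ ^ 2) := by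
    simpa [covMatrix] using congrFun (congrFun hcov 1) 1
  have hd := one_sub_sq_pos hθ
  have m0 := hB.memLp_coord 1 0
  have m1 := hB.memLp_coord 1 1
  have m1' := m1.const_mul θ
  have hg : HasGaussianLaw (fun ω => (X 1 ω 0 + θ * X 1 ω 1, X 1 ω 1)) P := by
    have h := (hB.gaussian.hasGaussianLaw_eval 1).map_fun
      (((ContinuousLinearMap.proj (R := ℝ) (φ := fun _ : Fin 2 => ℝ) 0) +
        θ • (ContinuousLinearMap.proj (R := ℝ) (φ := fun _ : Fin 2 => ℝ) 1)).prod
        (ContinuousLinearMap.proj (R := ℝ) (φ := fun _ : Fin 2 => ℝ) 1))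
    simpa using h
  have hind : IndepFun (fun ω => X 1 ω 0 + θ * X 1 ω 1) (fun ω => X 1 ω 1) P := by
    refine hg.indepFun_of_covariance_eq_zero ?_
    have := covariance_add_left m0 m1' m1
    rw [show (fun ω => X 1 ω 0) + (fun ω => θ * X 1 ω 1) = fun ω => X 1 ω 0 + θ * X 1 ω 1 from rfl]
      at this
    rw [this, covariance_const_mul_left, c01, c11]
    ring
  have hmean : ∫ ω, X 1 ω 0 + θ * X 1 ω 1 ∂P = 0 := by
    rw [integral_add (m0.integrable one_le_two) (m1'.integrable one_le_two), integral_const_mul,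
      hB.centered, hB.centered]
    simp
  have hvar : Var[fun ω => X 1 ω 0 + θ * X 1 ω 1; P] = 1 := by
    rw [variance_fun_add m0 m1', variance_const_mul, covariance_const_mul_right,
      ← covariance_self (hB.hasGaussianLaw_coord _ _).aemeasurable,
      ← covariance_self (hB.hasGaussianLaw_coord _ _).aemeasurable, c00, c01, c11]
    field_simp
    ring
  have hU := hg.fst.map_eq_gaussianReal
  have hV := hg.snd.map_eq_gaussianReal
  rw [hmean, hvar, Real.toNNReal_one] at hU
  rw [hB.centered, ← covariance_self (hB.hasGaussianLaw_coord _ _).aemeasurable, c11] at hV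
  have hprod := (indepFun_iff_map_prod_eq_prod_map_map hg.fst.aemeasurable
    hg.snd.aemeasurable).1 hind
  rw [hU, hV] at hprod
  rw [hpair, ← map_prod_gaussianReal hθ, ← hprod,
    AEMeasurable.map_map_of_aemeasurable (by fun_prop) hg.aemeasurable]
  congr 1
  ext ω <;> simp

/-- The sum `a X₁(y₁⁻²) + b X₂(y₂⁻²)` with times rounded down to multiples of `1 / N`. -/
noncomputable def gridSum (a b : ℝ) (N : ℕ) (p : (ℕ → Fin 2 → ℝ) × (ℝ × ℝ)) : ℝ :=
  a * p.1 ⌊(p.2.1 ^ 2)⁻¹ * N⌋₊ 0 + b * p.1 ⌊(p.2.2 ^ 2)⁻¹ * N⌋₊ 1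

/-- The variance of `gridSum` for fixed `y`. -/
noncomputable def gridVariance (a b θ : ℝ) (N : ℕ) (y : ℝ × ℝ) : ℝ :=
  a ^ 2 * (⌊(y.1 ^ 2)⁻¹ * N⌋₊ / N) * (1 / (1 - θ ^ 2))
    + 2 * a * b * min (⌊(y.1 ^ 2)⁻¹ * N⌋₊ / N : ℝ) (⌊(y.2 ^ 2)⁻¹ * N⌋₊ / N) * (-θ / (1 - θ ^ 2))
    + b ^ 2 * (⌊(y.2 ^ 2)⁻¹ * N⌋₊ / N) * (1 / (1 - θ ^ 2))

/-- Evaluating a sequence at a random index is measurable because the index set ℕ is countable. For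
the uncountable family X this is not available, hence the grid. -/
lemma measurable_gridSum (a b : ℝ) (N : ℕ) : Measurable (gridSum a b N) := by
  have key : ∀ (f : (ℕ → Fin 2 → ℝ) × (ℝ × ℝ) → ℕ) (_ : Measurable f) (i : Fin 2),
      Measurable fun p : (ℕ → Fin 2 → ℝ) × (ℝ × ℝ) => p.1 (f p) i := fun f hf i => by
    have h : Measurable fun q : (ℕ → Fin 2 → ℝ) × ℕ => q.1 q.2 i :=
      measurable_from_prod_countable_left fun n => by fun_prop
    exact h.comp (measurable_fst.prodMk hf)
  unfold gridSum
  exact ((key _ (by fun_prop) 0).const_mul a).add ((key _ (by fun_prop) 1).const_mul b)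

lemma measurable_gridVariance (a b θ : ℝ) (N : ℕ) : Measurable (gridVariance a b θ N) := by
  unfold gridVariance
  fun_prop

lemma measurable_mixVariance (a b θ : ℝ) : Measurable (mixVariance a b θ) := by
  unfold mixVariance
  fun_prop

lemma tendsto_gridVariance (a b θ : ℝ) {y : ℝ × ℝ} (h1 : y.1 ≠ 0) (h2 : y.2 ≠ 0) :
    Tendsto (fun N => gridVariance a b θ N y) atTop (𝓝 (mixVariance a b θ y)) := by
  have t : ∀ z : ℝ, Tendsto (fun N : ℕ => (⌊(z ^ 2)⁻¹ * N⌋₊ : ℝ) / N) atTop (𝓝 (z ^ 2)⁻¹) :=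
    fun z => (tendsto_nat_floor_mul_div_atTop (by positivity)).comp tendsto_natCast_atTop_atTop
  have hlim := ((((t y.1).const_mul (a ^ 2)).mul_const (1 / (1 - θ ^ 2))).add
    ((((t y.1).min (t y.2)).const_mul (2 * a * b)).mul_const (-θ / (1 - θ ^ 2)))).add
    (((t y.2).const_mul (b ^ 2)).mul_const (1 / (1 - θ ^ 2)))
  have p1 : 0 < y.1 ^ 2 := by positivity
  have p2 : 0 < y.2 ^ 2 := by positivity
  have hmin : min (y.1 ^ 2)⁻¹ (y.2 ^ 2)⁻¹ = (max (y.1 ^ 2) (y.2 ^ 2))⁻¹ := by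
    rcases le_total (y.1 ^ 2) (y.2 ^ 2) with h | h
    · rw [max_eq_right h, min_eq_right (by gcongr)]
    · rw [max_eq_left h, min_eq_left (by gcongr)]
  have hmix : mixVariance a b θ y = a ^ 2 * (y.1 ^ 2)⁻¹ * (1 / (1 - θ ^ 2))
      + 2 * a * b * min (y.1 ^ 2)⁻¹ (y.2 ^ 2)⁻¹ * (-θ / (1 - θ ^ 2))
      + b ^ 2 * (y.2 ^ 2)⁻¹ * (1 / (1 - θ ^ 2)) := by
    rw [hmin, mixVariance]
    simp only [div_eq_mul_inv, mul_inv]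
    ring
  rw [hmix]
  exact hlim

/-- By independence the joint law of the grid values of X and of Y is a product. For fixed y the
inner integral is the characteristic function of a centered normal law with variance `gridVariance`.
-/
lemma IsModel.integral_exp_gridSum (h : IsModel θ X Y P) (hθ : θ ∈ Ioo (-1 : ℝ) 1) (a b : ℝ)
    {N : ℕ} (hN : N ≠ 0) (s : ℝ) :
    ∫ ω, Complex.exp (s * gridSum a b N (fun m => X (m / N) ω, (Y ω 0, Y ω 1)) * Complex.I) ∂P
      = ∫ y, Complex.exp (-((Real.toNNReal (gridVariance a b θ N y) : ℝ) : ℂ) * s ^ 2 / 2)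
          ∂planeNormal θ := by
  have hB := h.brownian
  have := hB.isProbabilityMeasure
  have := isProbabilityMeasure_planeNormal hθ
  have hXm : AEMeasurable (fun ω (m : ℕ) => X (m / N) ω) P :=
    aemeasurable_pi_lambda _ fun m => hB.gaussian.aemeasurable _
  have hYm : AEMeasurable (fun ω => (Y ω 0, Y ω 1)) P := by
    have hf : Measurable fun z : Fin 2 → ℝ => (z 0, z 1) := by fun_prop
    exact hf.comp_aemeasurable h.same_law.aemeasurable_fst
  have hind : IndepFun (fun ω (m : ℕ) => X (m / N) ω) (fun ω => (Y ω 0, Y ω 1)) P :=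
    h.indep.comp (φ := fun (x : ℝ≥0 → Fin 2 → ℝ) (m : ℕ) => x (m / N))
      (ψ := fun z : Fin 2 → ℝ => (z 0, z 1)) (by fun_prop) (by fun_prop)
  have hprod := (indepFun_iff_map_prod_eq_prod_map_map hXm hYm).1 hind
  rw [h.map_pair hθ] at hprod
  have hFm : Measurable fun p => Complex.exp (s * gridSum a b N p * Complex.I) := by
    have := measurable_gridSum a b N
    fun_prop
  have := Measure.isProbabilityMeasure_map hXm
  rw [← integral_map (f := fun p => Complex.exp (s * gridSum a b N p * Complex.I))
    (hXm.prodMk hYm) hFm.aestronglyMeasurable, hprod, integral_prod_symm]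
  · refine integral_congr_ae (ae_of_all _ fun y => ?_)
    dsimp only
    have hZ := hB.map_linearCombination hN ⌊(y.1 ^ 2)⁻¹ * N⌋₊ ⌊(y.2 ^ 2)⁻¹ * N⌋₊ a b
    have hcf := charFun_gaussianReal (μ := 0) (v := Real.toNNReal (gridVariance a b θ N y)) s
    have hvar : gridVariance a b θ N y = a ^ 2 * (⌊(y.1 ^ 2)⁻¹ * N⌋₊ / N) * covMatrix (X 1) P 0 0
        + 2 * a * b * min (⌊(y.1 ^ 2)⁻¹ * N⌋₊ / N : ℝ) (⌊(y.2 ^ 2)⁻¹ * N⌋₊ / N)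
          * covMatrix (X 1) P 0 1
        + b ^ 2 * (⌊(y.2 ^ 2)⁻¹ * N⌋₊ / N) * covMatrix (X 1) P 1 1 := by
      rw [h.covMatrix_eq hθ]
      simp [gridVariance]
    rw [← hvar] at hZ
    rw [← hZ, charFun_apply_real, integral_map] at hcf
    · have hFy : Measurable fun x : ℕ → Fin 2 → ℝ =>
          Complex.exp (s * gridSum a b N (x, y) * Complex.I) := hFm.comp measurable_prodMk_right
      rw [integral_map hXm hFy.aestronglyMeasurable]
      simp only [gridSum]
      rw [hcf]
      congr 1
      push_cast
      ring
    · have e0 := (hB.hasGaussianLaw_coord (⌊(y.1 ^ 2)⁻¹ * N⌋₊ / N) 0).aemeasurable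
      have e1 := (hB.hasGaussianLaw_coord (⌊(y.2 ^ 2)⁻¹ * N⌋₊ / N) 1).aemeasurable
      fun_prop
    · fun_prop
  · refine (integrable_const (1 : ℝ)).mono' hFm.aestronglyMeasurable (ae_of_all _ fun p => ?_)
    rw [← Complex.ofReal_mul, Complex.norm_exp_ofReal_mul_I]

lemma IsModel.tendsto_gridSum (h : IsModel θ X Y P) (w : Fin 2 → ℝ) :
    ∀ᵐ ω ∂P, Tendsto (fun N : ℕ => gridSum (w 0) (w 1) N (fun m => X (m / N) ω, (Y ω 0, Y ω 1)))
      atTop (𝓝 (stoppedSum w X Y ω)) := by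
  filter_upwards [h.brownian.continuous_paths] with ω hω
  have key : ∀ i : Fin 2, Tendsto
      (fun N : ℕ => X ((⌊(Y ω i ^ 2)⁻¹ * N⌋₊ : ℝ≥0) / N) ω i) atTop
      (𝓝 (X (Real.toNNReal ((Y ω i ^ 2)⁻¹)) ω i)) := fun i => by
    have hc : Continuous fun t => X t ω i := (continuous_apply i).comp hω
    refine (hc.tendsto _).comp ?_
    rw [← NNReal.tendsto_coe, Real.coe_toNNReal _ (by positivity)]
    push_cast
    exact (tendsto_nat_floor_mul_div_atTop (by positivity)).comp tendsto_natCast_atTop_atTop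
  simp only [stoppedSum, gridSum, Fin.sum_univ_two]
  exact ((key 0).const_mul _).add ((key 1).const_mul _)

lemma IsModel.aemeasurable_gridSum (h : IsModel θ X Y P) (a b : ℝ) (N : ℕ) :
    AEMeasurable (fun ω => gridSum a b N (fun m => X (m / N) ω, (Y ω 0, Y ω 1))) P := by
  have hXm : AEMeasurable (fun ω (m : ℕ) => X (m / N) ω) P :=
    aemeasurable_pi_lambda _ fun m => h.brownian.gaussian.aemeasurable _
  have hYm : AEMeasurable (fun ω => (Y ω 0, Y ω 1)) P := by
    have hf : Measurable fun z : Fin 2 → ℝ => (z 0, z 1) := by fun_prop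
    exact hf.comp_aemeasurable h.same_law.aemeasurable_fst
  exact (measurable_gridSum a b N).comp_aemeasurable (hXm.prodMk hYm)

lemma IsModel.aemeasurable_stoppedSum (h : IsModel θ X Y P) (w : Fin 2 → ℝ) :
    AEMeasurable (stoppedSum w X Y) P :=
  aemeasurable_of_tendsto_metrizable_ae' (fun N => h.aemeasurable_gridSum (w 0) (w 1) N)
    (h.tendsto_gridSum w)

/-- Both sides are limits of the same integrals as N → ∞: path continuity handles the integrals over
Ω, convergence of the variances those over y. All integrands are bounded by 1. -/
lemma IsModel.charFun_stoppedSum (h : IsModel θ X Y P) (hθ : θ ∈ Ioo (-1 : ℝ) 1) (w : Fin 2 → ℝ)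
    (s : ℝ) :
    charFun (P.map (stoppedSum w X Y)) s
      = ∫ y, Complex.exp (-((Real.toNNReal (mixVariance (w 0) (w 1) θ y) : ℝ) : ℂ) * s ^ 2 / 2)
          ∂planeNormal θ := by
  have := h.brownian.isProbabilityMeasure
  have := isProbabilityMeasure_planeNormal hθ
  rw [charFun_apply_real, integral_map (h.aemeasurable_stoppedSum w) (by fun_prop)]
  refine tendsto_nhds_unique
    (f := fun N : ℕ => ∫ ω, Complex.exp
      (s * gridSum (w 0) (w 1) N (fun m => X (m / N) ω, (Y ω 0, Y ω 1)) * Complex.I) ∂P)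
    (l := atTop) ?_ ?_
  · refine tendsto_integral_of_dominated_convergence (fun _ => 1) (fun N => ?_)
      (integrable_const _) (fun N => ae_of_all _ fun ω => ?_) ?_
    · have := h.aemeasurable_gridSum (w 0) (w 1) N
      exact AEMeasurable.aestronglyMeasurable (by fun_prop)
    · rw [← Complex.ofReal_mul, Complex.norm_exp_ofReal_mul_I]
    · filter_upwards [h.tendsto_gridSum w] with ω hω
      have hc : Continuous fun x : ℝ => Complex.exp (s * x * Complex.I) := by fun_prop
      exact (hc.tendsto _).comp hω
  · have heq : ∀ᶠ N : ℕ in atTop, ∫ y, Complex.exp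
        (-((Real.toNNReal (gridVariance (w 0) (w 1) θ N y) : ℝ) : ℂ) * s ^ 2 / 2) ∂planeNormal θ
        = ∫ ω, Complex.exp
          (s * gridSum (w 0) (w 1) N (fun m => X (m / N) ω, (Y ω 0, Y ω 1)) * Complex.I) ∂P := by
      filter_upwards [eventually_ne_atTop 0] with N hN
      rw [h.integral_exp_gridSum hθ _ _ hN]
    refine Tendsto.congr' heq ?_
    refine tendsto_integral_of_dominated_convergence (fun _ => 1) (fun N => ?_)
      (integrable_const _) (fun N => ae_of_all _ fun y => ?_) ?_
    · have := measurable_gridVariance (w 0) (w 1) θ N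
      exact Measurable.aestronglyMeasurable (by fun_prop)
    · rw [Complex.norm_exp, Real.exp_le_one_iff]
      have : (-((Real.toNNReal (gridVariance (w 0) (w 1) θ N y) : ℝ) : ℂ) * s ^ 2 / 2)
          = ((-(Real.toNNReal (gridVariance (w 0) (w 1) θ N y) : ℝ) * s ^ 2 / 2 : ℝ) : ℂ) := by
        push_cast; ring
      rw [this, Complex.ofReal_re]
      have : 0 ≤ (Real.toNNReal (gridVariance (w 0) (w 1) θ N y) : ℝ) * s ^ 2 := by positivity
      linarith
    · filter_upwards [ae_planeNormal_ne_zero θ] with y hy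
      have hc : Continuous fun x : ℝ =>
          Complex.exp (-((Real.toNNReal x : ℝ) : ℂ) * s ^ 2 / 2) := by fun_prop
      exact (hc.tendsto _).comp (tendsto_gridVariance (w 0) (w 1) θ hy.1 hy.2)

end Model

/-! ### The mixture density and its characteristic function -/

lemma one_sub_sq_add_pos {a b θ : ℝ} (ha : 0 ≤ a) (hb : 0 ≤ b) (hab : 0 < a + b)
    (hθ : θ ∈ Ioo (-1 : ℝ) 1) : 0 < a ^ 2 + (b ^ 2 - 2 * a * b * θ) := by
  have h1 : 0 ≤ a * b := mul_nonneg ha hb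
  rcases h1.eq_or_lt with h | h
  · have : a ^ 2 + (b ^ 2 - 2 * a * b * θ) = (a + b) ^ 2 := by
      linear_combination (2 + 2 * θ) * h
    rw [this]
    positivity
  · nlinarith [sq_nonneg (a - b), mul_pos h (sub_pos.2 hθ.2)]

/-- Replacing y₁² and y₂² by their maximum only decreases the two square terms, and what remains is
a positive multiple of a² + b² - 2abθ. -/
lemma mixVariance_pos {a b θ : ℝ} (ha : 0 ≤ a) (hb : 0 ≤ b) (hab : 0 < a + b)
    (hθ : θ ∈ Ioo (-1 : ℝ) 1) {y : ℝ × ℝ} (h1 : y.1 ≠ 0) (h2 : y.2 ≠ 0) :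
    0 < mixVariance a b θ y := by
  have hd := one_sub_sq_pos hθ
  have p1 : 0 < y.1 ^ 2 := by positivity
  have p2 : 0 < y.2 ^ 2 := by positivity
  have hM : 0 < max (y.1 ^ 2) (y.2 ^ 2) := lt_max_of_lt_left p1
  have e1 : a ^ 2 / (max (y.1 ^ 2) (y.2 ^ 2) * (1 - θ ^ 2)) ≤ a ^ 2 / (y.1 ^ 2 * (1 - θ ^ 2)) := by
    gcongr
    exact le_max_left _ _
  have e2 : b ^ 2 / (max (y.1 ^ 2) (y.2 ^ 2) * (1 - θ ^ 2)) ≤ b ^ 2 / (y.2 ^ 2 * (1 - θ ^ 2)) := by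
    gcongr
    exact le_max_right _ _
  have e3 : 0 < (a ^ 2 + (b ^ 2 - 2 * a * b * θ)) / (max (y.1 ^ 2) (y.2 ^ 2) * (1 - θ ^ 2)) :=
    div_pos (one_sub_sq_add_pos ha hb hab hθ) (by positivity)
  rw [add_div, sub_div] at e3
  unfold mixVariance
  linarith

lemma integrable_normalDensity {θ : ℝ} (hθ : θ ∈ Ioo (-1 : ℝ) 1) :
    Integrable (normalDensity θ) := by
  have := isProbabilityMeasure_planeNormal hθ
  have h := measure_univ (μ := planeNormal θ)
  rw [planeNormal, withDensity_apply _ MeasurableSet.univ, Measure.restrict_univ] at h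
  refine ⟨(measurable_normalDensity θ).aestronglyMeasurable, ?_⟩
  rw [hasFiniteIntegral_iff_ofReal (ae_of_all _ (normalDensity_nonneg θ)), h]
  exact ENNReal.one_lt_top

lemma integrable_kernel_mul {α β : Type*} [MeasurableSpace α] [MeasurableSpace β]
    {μ : Measure α} {ν : Measure β} [SFinite μ] [SFinite ν] {k : α × β → ℝ} {f : β → ℝ}
    (hk : Measurable k) (hk0 : ∀ p, 0 ≤ k p) (hki : ∀ y, Integrable (fun x => k (x, y)) μ)
    (hk1 : ∀ y, ∫ x, k (x, y) ∂μ ≤ 1) (hf : Integrable f ν) :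
    Integrable (fun p : α × β => k p * f p.2) (μ.prod ν) := by
  have hm : AEStronglyMeasurable (fun p : α × β => k p * f p.2) (μ.prod ν) :=
    hk.aestronglyMeasurable.mul hf.aestronglyMeasurable.comp_snd
  rw [integrable_prod_iff' hm]
  refine ⟨ae_of_all _ fun y => (hki y).mul_const (f y), ?_⟩
  have heq : ∀ y, ∫ x, ‖k (x, y) * f y‖ ∂μ = (∫ x, k (x, y) ∂μ) * ‖f y‖ := fun y => by
    simp only [norm_mul, Real.norm_of_nonneg (hk0 _), integral_mul_const]
  simp only [heq]
  refine hf.norm.mono' ?_ (ae_of_all _ fun y => ?_)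
  · exact hk.stronglyMeasurable.integral_prod_left'.aestronglyMeasurable.mul
      hf.norm.aestronglyMeasurable
  · have hnn : 0 ≤ ∫ x, k (x, y) ∂μ := integral_nonneg fun x => hk0 _
    rw [Real.norm_of_nonneg (by positivity)]
    exact mul_le_of_le_one_left (norm_nonneg _) (hk1 y)

lemma measurable_mixKernel (a b θ : ℝ) :
    Measurable fun p : ℝ × (ℝ × ℝ) =>
      gaussianPDFReal 0 (Real.toNNReal (mixVariance a b θ p.2)) p.1 := by
  have h1 := measurable_mixVariance a b θ
  exact measurable_uncurry_gaussianPDFReal.comp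
    (f := fun p : ℝ × (ℝ × ℝ) => ((0 : ℝ), Real.toNNReal (mixVariance a b θ p.2), p.1))
    (by fun_prop)

lemma measurable_mixIntegrand (a b θ : ℝ) :
    Measurable fun p : ℝ × (ℝ × ℝ) =>
      gaussianPDFReal 0 (Real.toNNReal (mixVariance a b θ p.2)) p.1 * normalDensity θ p.2 :=
  (measurable_mixKernel a b θ).mul ((measurable_normalDensity θ).comp measurable_snd)

lemma integrable_mixIntegrand (a b : ℝ) {θ : ℝ} (hθ : θ ∈ Ioo (-1 : ℝ) 1) :
    Integrable (fun p : ℝ × (ℝ × ℝ) =>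
      gaussianPDFReal 0 (Real.toNNReal (mixVariance a b θ p.2)) p.1 * normalDensity θ p.2)
      ((volume : Measure ℝ).prod (volume : Measure (ℝ × ℝ))) := by
  refine integrable_kernel_mul (measurable_mixKernel a b θ)
    (fun p => gaussianPDFReal_nonneg _ _ _)
    (fun y => integrable_gaussianPDFReal 0 (Real.toNNReal (mixVariance a b θ y))) (fun y => ?_)
    (integrable_normalDensity hθ)
  -- `gaussianPDFReal` with variance 0 is the zero function, so at degenerate y the mass is 0 rather
  -- than 1.
  by_cases h : Real.toNNReal (mixVariance a b θ y) = 0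
  · simp [h]
  · exact (integral_gaussianPDFReal_eq_one _ h).le

lemma mixDensity_nonneg (a b θ v : ℝ) : 0 ≤ mixDensity a b θ v :=
  integral_nonneg fun y => mul_nonneg (gaussianPDFReal_nonneg _ _ _) (normalDensity_nonneg θ y)

lemma measurable_mixDensity (a b θ : ℝ) : Measurable (mixDensity a b θ) :=
  (measurable_mixIntegrand a b θ).stronglyMeasurable.integral_prod_right'.measurable

lemma integrable_mixDensity (a b : ℝ) {θ : ℝ} (hθ : θ ∈ Ioo (-1 : ℝ) 1) :
    Integrable (mixDensity a b θ) :=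
  (integrable_mixIntegrand a b hθ).integral_prod_left

lemma charFun_mixDensity {a b θ : ℝ} (ha : 0 ≤ a) (hb : 0 ≤ b) (hab : 0 < a + b)
    (hθ : θ ∈ Ioo (-1 : ℝ) 1) (s : ℝ) :
    charFun (volume.withDensity fun v => ENNReal.ofReal (mixDensity a b θ v)) s
      = ∫ y, Complex.exp (-((Real.toNNReal (mixVariance a b θ y) : ℝ) : ℂ) * s ^ 2 / 2)
          ∂planeNormal θ := by
  rw [charFun_apply_real, planeNormal, integral_withDensity_eq_integral_toReal_smul
    (measurable_mixDensity a b θ).ennreal_ofReal (ae_of_all _ fun _ => ENNReal.ofReal_lt_top),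
    integral_withDensity_eq_integral_toReal_smul
    (measurable_normalDensity θ).ennreal_ofReal (ae_of_all _ fun _ => ENNReal.ofReal_lt_top)]
  simp only [ENNReal.toReal_ofReal (mixDensity_nonneg _ _ _ _),
    ENNReal.toReal_ofReal (normalDensity_nonneg _ _)]
  have hint : Integrable (fun p : ℝ × (ℝ × ℝ) =>
      (gaussianPDFReal 0 (Real.toNNReal (mixVariance a b θ p.2)) p.1 * normalDensity θ p.2) •
        Complex.exp (s * p.1 * Complex.I))
      ((volume : Measure ℝ).prod (volume : Measure (ℝ × ℝ))) := by
    refine (integrable_mixIntegrand a b hθ).norm.mono'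
      ((measurable_mixIntegrand a b θ).aestronglyMeasurable.smul
        (Measurable.aestronglyMeasurable (by fun_prop))) (ae_of_all _ fun p => ?_)
    rw [norm_smul, ← Complex.ofReal_mul, Complex.norm_exp_ofReal_mul_I, mul_one]
  calc ∫ v, mixDensity a b θ v • Complex.exp (s * v * Complex.I)
      = ∫ v, ∫ y, (gaussianPDFReal 0 (Real.toNNReal (mixVariance a b θ y)) v
          * normalDensity θ y) • Complex.exp (s * v * Complex.I) := by
        refine integral_congr_ae (ae_of_all _ fun v => ?_)
        exact (integral_smul_const _ _).symm
    _ = ∫ y, ∫ v, (gaussianPDFReal 0 (Real.toNNReal (mixVariance a b θ y)) v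
          * normalDensity θ y) • Complex.exp (s * v * Complex.I) := integral_integral_swap hint
    _ = _ := by
        refine integral_congr_ae ?_
        filter_upwards [ae_volume_ne_zero] with y hy
        have hpos := mixVariance_pos ha hb hab hθ hy.1 hy.2
        have hne : Real.toNNReal (mixVariance a b θ y) ≠ 0 := by
          rwa [Ne, Real.toNNReal_eq_zero, not_le]
        have hcf := charFun_gaussianReal (μ := 0) (v := Real.toNNReal (mixVariance a b θ y)) s
        rw [charFun_apply_real, integral_gaussianReal_eq_integral_smul hne] at hcf
        simp only [mul_comm _ (normalDensity θ y), mul_smul]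
        rw [integral_smul, hcf]
        congr 2
        push_cast
        ring

lemma IsModel.hasLaw_stoppedSum {Ω : Type*} [MeasurableSpace Ω] {P : Measure Ω} {θ : ℝ}
    {X : ℝ≥0 → Ω → (Fin 2 → ℝ)} {Y : Ω → (Fin 2 → ℝ)} (h : IsModel θ X Y P)
    (hθ : θ ∈ Ioo (-1 : ℝ) 1) {a b : ℝ} (ha : 0 ≤ a) (hb : 0 ≤ b) (hab : 0 < a + b) :
    HasLaw (stoppedSum ![a, b] X Y)
      (volume.withDensity fun v => ENNReal.ofReal (mixDensity a b θ v)) P := by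
  have := h.brownian.isProbabilityMeasure
  have hm := h.aemeasurable_stoppedSum ![a, b]
  have := Measure.isProbabilityMeasure_map hm
  have := isFiniteMeasure_withDensity_ofReal (integrable_mixDensity a b hθ).2
  refine ⟨hm, Measure.ext_of_charFun ?_⟩
  ext s
  rw [h.charFun_stoppedSum hθ, charFun_mixDensity ha hb hab hθ]
  simp

/-! ### Reduction to an integral over the ratio of the coordinates -/

/-- Substitution y₁ = xy₂ for fixed y₂ ≠ 0, with Jacobian |y₂|, followed by Tonelli. -/
lemma lintegral_preimage_div {S : Set ℝ} (hS : MeasurableSet S) {φ : ℝ × ℝ → ENNReal}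
    (hφ : Measurable φ) :
    ∫⁻ y in {y : ℝ × ℝ | y.1 / y.2 ∈ S}, φ y
      = ∫⁻ x in S, ∫⁻ y : ℝ, ENNReal.ofReal |y| * φ (x * y, y) := by
  have hT : MeasurableSet {y : ℝ × ℝ | y.1 / y.2 ∈ S} :=
    hS.preimage (measurable_fst.div measurable_snd)
  have hm : Measurable fun p : ℝ × ℝ =>
      S.indicator (fun x => ENNReal.ofReal |p.1| * φ (x * p.1, p.1)) p.2 := by
    have h : Measurable ((Prod.snd ⁻¹' S).indicator
      fun p : ℝ × ℝ => ENNReal.ofReal |p.1| * φ (p.2 * p.1, p.1)) :=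
      Measurable.indicator (by fun_prop) (hS.preimage measurable_snd)
    exact h
  rw [← lintegral_indicator hT, Measure.volume_eq_prod,
    lintegral_prod_symm _ (hφ.indicator hT).aemeasurable]
  have h0 : ∀ᵐ y : ℝ, y ≠ 0 := by simp [ae_iff]
  calc ∫⁻ y, ∫⁻ t, {y : ℝ × ℝ | y.1 / y.2 ∈ S}.indicator φ (t, y)
      = ∫⁻ y, ∫⁻ x, S.indicator (fun x => ENNReal.ofReal |y| * φ (x * y, y)) x := by
        refine lintegral_congr_ae ?_
        filter_upwards [h0] with y hy
        have hy' : Measurable fun t => {y : ℝ × ℝ | y.1 / y.2 ∈ S}.indicator φ (t, y) :=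
          (hφ.indicator hT).comp measurable_prodMk_right
        calc ∫⁻ t, {y : ℝ × ℝ | y.1 / y.2 ∈ S}.indicator φ (t, y)
            = ∫⁻ x, ENNReal.ofReal |y| * {y : ℝ × ℝ | y.1 / y.2 ∈ S}.indicator φ (x * y, y) := by
              nth_rewrite 1 [← Real.smul_map_volume_mul_right hy]
              rw [lintegral_smul_measure, lintegral_map hy' (by fun_prop), smul_eq_mul]
              exact (lintegral_const_mul _ (hy'.comp (measurable_mul_const y))).symm
          _ = _ := ?_
        refine lintegral_congr fun x => ?_
        by_cases hx : x ∈ S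
        · rw [indicator_of_mem hx, indicator_of_mem]
          simpa [hy] using hx
        · rw [indicator_of_notMem hx, indicator_of_notMem, mul_zero]
          simpa [hy] using hx
    _ = ∫⁻ x, ∫⁻ y, S.indicator (fun x => ENNReal.ofReal |y| * φ (x * y, y)) x :=
        lintegral_lintegral_swap hm.aemeasurable
    _ = ∫⁻ x in S, ∫⁻ y, ENNReal.ofReal |y| * φ (x * y, y) := by
        rw [← lintegral_indicator hS]
        refine lintegral_congr fun x => ?_
        by_cases hx : x ∈ S
        · simp [hx]
        · simp [hx]

/-- Up to normalization this is the variance 1/c of the centered normal law with that variance. -/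
lemma lintegral_sq_mul_exp {c : ℝ} (hc : 0 < c) :
    ∫⁻ y : ℝ, ENNReal.ofReal (y ^ 2 * Real.exp (-(c * y ^ 2) / 2))
      = ENNReal.ofReal (Real.sqrt (2 * Real.pi) / (c * Real.sqrt c)) := by
  have hv : Real.toNNReal (1 / c) ≠ 0 := by
    rw [Ne, Real.toNNReal_eq_zero, not_le]
    positivity
  have hcoe : ((Real.toNNReal (1 / c) : ℝ≥0) : ℝ) = 1 / c := Real.coe_toNNReal _ (by positivity)
  have hint : Integrable (fun y : ℝ => y ^ 2) (gaussianReal 0 (Real.toNNReal (1 / c))) := by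
    have h := (memLp_id_gaussianReal (μ := 0) (v := Real.toNNReal (1 / c)) 2).integrable_sq
    simpa using h
  have hvar : ∫ y, y ^ 2 ∂gaussianReal 0 (Real.toNNReal (1 / c)) = 1 / c := by
    have h := variance_fun_id_gaussianReal (μ := 0) (v := Real.toNNReal (1 / c))
    rw [variance_eq_integral (by fun_prop), integral_id_gaussianReal, hcoe] at h
    simpa using h
  have hpt : ∀ y : ℝ, y ^ 2 * Real.exp (-(c * y ^ 2) / 2)
      = Real.sqrt (2 * Real.pi) / Real.sqrt c
        * (gaussianPDFReal 0 (Real.toNNReal (1 / c)) y * y ^ 2) := fun y => by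
    have h1 : 0 < Real.sqrt c := by positivity
    have h2 : 0 < Real.sqrt (2 * Real.pi) := by positivity
    rw [gaussianPDFReal, hcoe, mul_one_div, Real.sqrt_div (by positivity)]
    have : -(y - 0) ^ 2 / (2 * (1 / c)) = -(c * y ^ 2) / 2 := by
      field_simp
      ring
    rw [this]
    field_simp
  have hI : ∫ y : ℝ, y ^ 2 * Real.exp (-(c * y ^ 2) / 2)
      = Real.sqrt (2 * Real.pi) / (c * Real.sqrt c) := by
    simp only [hpt]
    rw [integral_const_mul]
    rw [integral_gaussianReal_eq_integral_smul hv] at hvar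
    simp only [smul_eq_mul] at hvar
    rw [hvar]
    field_simp
  rw [← hI, ofReal_integral_eq_lintegral_ofReal]
  · apply Integrable.of_integral_ne_zero
    rw [hI]
    positivity
  · exact ae_of_all _ fun y => by positivity

/-- With `y₁ = x y₂` and `|x| ≤ 1`, the variance `mixVariance a b θ y` is
`ratioNum a b θ x / (x² y₂² (1 - θ²))`. -/
noncomputable def ratioNum (a b θ x : ℝ) : ℝ := a ^ 2 + (b ^ 2 - 2 * a * b * θ) * x ^ 2

/-- The quantity whose power `-3/2` arises from integrating out the modulus. -/
noncomputable def ratioDen (a b θ η v x : ℝ) : ℝ :=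
  (x ^ 2 + 2 * η * x + 1) * ratioNum a b θ x + v ^ 2 * (1 - θ ^ 2) * x ^ 2

/-- The integrand, in the ratio of the coordinates, of the mixture density. -/
noncomputable def ratioKernel (a b θ η v x : ℝ) : ℝ :=
  x * ratioNum a b θ x / (ratioDen a b θ η v x * Real.sqrt (ratioDen a b θ η v x))

/-- The part of the mixture density coming from the vectors `y` with `|y₁| < |y₂|`. -/
noncomputable def halfDensity (a b θ v : ℝ) : ℝ :=
  (1 - θ ^ 2) / (2 * Real.pi) *
    ∫ x in (0 : ℝ)..1, (ratioKernel a b θ θ v x + ratioKernel a b θ (-θ) v x)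

section Bounds

variable {a b θ : ℝ}

lemma ratioNum_ge (a b θ : ℝ) {x : ℝ} (hx : x ^ 2 ≤ 1) :
    (a ^ 2 + (b ^ 2 - 2 * a * b * θ)) * x ^ 2 ≤ ratioNum a b θ x := by
  unfold ratioNum
  nlinarith [sq_nonneg a]

lemma ratioNum_pos (ha : 0 ≤ a) (hb : 0 ≤ b) (hab : 0 < a + b) (hθ : θ ∈ Ioo (-1 : ℝ) 1)
    {x : ℝ} (hx : x ^ 2 ≤ 1) (hx0 : x ≠ 0) : 0 < ratioNum a b θ x :=
  lt_of_lt_of_le (mul_pos (one_sub_sq_add_pos ha hb hab hθ) (by positivity)) (ratioNum_ge a b θ hx)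

lemma quadratic_ge (η x : ℝ) : 1 - η ^ 2 ≤ x ^ 2 + 2 * η * x + 1 := by
  nlinarith [sq_nonneg (x + η)]

lemma ratioDen_ge {η v x : ℝ} (hη : η ^ 2 = θ ^ 2) (hθ : θ ∈ Ioo (-1 : ℝ) 1)
    (hN : 0 ≤ ratioNum a b θ x) :
    (1 - θ ^ 2) * ratioNum a b θ x ≤ ratioDen a b θ η v x := by
  have hd := one_sub_sq_pos hθ
  have h1 := mul_le_mul_of_nonneg_right (quadratic_ge η x) hN
  have h2 : 0 ≤ v ^ 2 * (1 - θ ^ 2) * x ^ 2 := by positivity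
  rw [hη] at h1
  unfold ratioDen
  linarith

lemma ratioKernel_nonneg (ha : 0 ≤ a) (hb : 0 ≤ b) (hab : 0 < a + b) (hθ : θ ∈ Ioo (-1 : ℝ) 1)
    {η v x : ℝ} (hη : η ^ 2 = θ ^ 2) (hx : x ∈ Icc (0 : ℝ) 1) :
    0 ≤ ratioKernel a b θ η v x := by
  have hd := one_sub_sq_pos hθ
  rcases hx.1.eq_or_lt with rfl | h0
  · simp [ratioKernel]
  have hN := ratioNum_pos ha hb hab hθ (x := x) (by nlinarith [hx.1, hx.2]) h0.ne'
  have hD := ratioDen_ge (v := v) hη hθ hN.le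
  have : 0 < ratioDen a b θ η v x := lt_of_lt_of_le (by positivity) hD
  unfold ratioKernel
  positivity

/-- Combine D ≥ (1 - θ²)N with N ≥ (a² + b² - 2abθ)x², where N and D are `ratioNum` and `ratioDen`:
one factor N cancels and the factor x is absorbed by √D. The bound is uniform in x and v, even for a
= 0, where N vanishes at x = 0. -/
lemma ratioKernel_le (ha : 0 ≤ a) (hb : 0 ≤ b) (hab : 0 < a + b) (hθ : θ ∈ Ioo (-1 : ℝ) 1)
    {η v x : ℝ} (hη : η ^ 2 = θ ^ 2) (hx : x ∈ Icc (0 : ℝ) 1) :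
    ratioKernel a b θ η v x ≤ 1 / ((1 - θ ^ 2) * Real.sqrt (1 - θ ^ 2)
      * Real.sqrt (a ^ 2 + (b ^ 2 - 2 * a * b * θ))) := by
  have hd := one_sub_sq_pos hθ
  have hκ := one_sub_sq_add_pos ha hb hab hθ
  rcases hx.1.eq_or_lt with rfl | h0
  · simp only [ratioKernel, zero_mul, zero_div]
    positivity
  have hx2 : x ^ 2 ≤ 1 := by nlinarith [hx.1, hx.2]
  have hN := ratioNum_pos ha hb hab hθ hx2 h0.ne'
  have hD := ratioDen_ge (v := v) hη hθ hN.le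
  have hD0 : 0 < ratioDen a b θ η v x := lt_of_lt_of_le (by positivity) hD
  have hs : Real.sqrt (1 - θ ^ 2) * (Real.sqrt (a ^ 2 + (b ^ 2 - 2 * a * b * θ)) * x)
      ≤ Real.sqrt (ratioDen a b θ η v x) := by
    calc Real.sqrt (1 - θ ^ 2) * (Real.sqrt (a ^ 2 + (b ^ 2 - 2 * a * b * θ)) * x)
        = Real.sqrt ((1 - θ ^ 2) * ((a ^ 2 + (b ^ 2 - 2 * a * b * θ)) * x ^ 2)) := by
          rw [Real.sqrt_mul hd.le, Real.sqrt_mul hκ.le, Real.sqrt_sq h0.le]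
      _ ≤ _ := by
          apply Real.sqrt_le_sqrt
          exact le_trans (mul_le_mul_of_nonneg_left (ratioNum_ge a b θ hx2) hd.le) hD
  unfold ratioKernel
  rw [div_le_div_iff₀ (by positivity) (by positivity)]
  calc x * ratioNum a b θ x * ((1 - θ ^ 2) * Real.sqrt (1 - θ ^ 2)
        * Real.sqrt (a ^ 2 + (b ^ 2 - 2 * a * b * θ)))
      = ((1 - θ ^ 2) * ratioNum a b θ x) *
        (Real.sqrt (1 - θ ^ 2) * (Real.sqrt (a ^ 2 + (b ^ 2 - 2 * a * b * θ)) * x)) := by ring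
    _ ≤ ratioDen a b θ η v x * Real.sqrt (ratioDen a b θ η v x) := by gcongr
    _ = _ := by ring

lemma measurable_ratioKernel (a b θ η v : ℝ) : Measurable (ratioKernel a b θ η v) := by
  unfold ratioKernel ratioDen ratioNum
  fun_prop

lemma intervalIntegrable_ratioKernel (ha : 0 ≤ a) (hb : 0 ≤ b) (hab : 0 < a + b)
    (hθ : θ ∈ Ioo (-1 : ℝ) 1) {η : ℝ} (v : ℝ) (hη : η ^ 2 = θ ^ 2) :
    IntervalIntegrable (ratioKernel a b θ η v) volume 0 1 := by
  rw [intervalIntegrable_iff_integrableOn_Icc_of_le zero_le_one]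
  refine Measure.integrableOn_of_bounded (M := 1 / ((1 - θ ^ 2) * Real.sqrt (1 - θ ^ 2)
      * Real.sqrt (a ^ 2 + (b ^ 2 - 2 * a * b * θ)))) (by simp)
    (measurable_ratioKernel a b θ η v).aestronglyMeasurable ?_
  refine (ae_restrict_iff' measurableSet_Icc).2 (ae_of_all _ fun x hx => ?_)
  rw [Real.norm_of_nonneg (ratioKernel_nonneg ha hb hab hθ hη hx)]
  exact ratioKernel_le ha hb hab hθ hη hx

end Bounds

variable {a b θ : ℝ}

lemma mixVariance_ratio (a b θ : ℝ) {x y : ℝ} (hx : x ^ 2 ≤ 1) (hx0 : x ≠ 0) (hy : y ≠ 0) :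
    mixVariance a b θ (x * y, y) = ratioNum a b θ x / (x ^ 2 * y ^ 2 * (1 - θ ^ 2)) := by
  have hmax : max ((x * y) ^ 2) (y ^ 2) = y ^ 2 := by
    rw [mul_pow]
    exact max_eq_right (mul_le_of_le_one_left (sq_nonneg y) hx)
  unfold mixVariance ratioNum
  simp only [hmax]
  rcases eq_or_ne (1 - θ ^ 2) 0 with hd | hd
  · simp [hd]
  · field_simp
    ring

/-- For fixed x the exponents of both Gaussian factors are multiples of y² and add up to -(D/N)y²/2.
The normalization of the conditional density supplies a further |y|, which produces the second
moment. -/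
lemma abs_mul_mixIntegrand (ha : 0 ≤ a) (hb : 0 ≤ b) (hab : 0 < a + b) (hθ : θ ∈ Ioo (-1 : ℝ) 1)
    (v : ℝ) {x y : ℝ} (hx : x ^ 2 ≤ 1) (hx0 : x ≠ 0) (hy : y ≠ 0) :
    |y| * (gaussianPDFReal 0 (Real.toNNReal (mixVariance a b θ (x * y, y))) v
        * normalDensity θ (x * y, y))
      = (1 - θ ^ 2) * |x| / (2 * Real.pi * (Real.sqrt (2 * Real.pi) * Real.sqrt (ratioNum a b θ x)))
        * (y ^ 2 * Real.exp (-(ratioDen a b θ θ v x / ratioNum a b θ x * y ^ 2) / 2)) := by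
  have hd := one_sub_sq_pos hθ
  have hN := ratioNum_pos ha hb hab hθ hx hx0
  have hy2 : 0 < y ^ 2 := by positivity
  have hx2 : 0 < x ^ 2 := by positivity
  have hsq : Real.sqrt (2 * Real.pi * (ratioNum a b θ x / (x ^ 2 * y ^ 2 * (1 - θ ^ 2))))
      = Real.sqrt (2 * Real.pi) * Real.sqrt (ratioNum a b θ x)
        / (|x| * |y| * Real.sqrt (1 - θ ^ 2)) := by
    rw [Real.sqrt_mul (x := 2 * Real.pi) (by positivity), Real.sqrt_div hN.le,
      Real.sqrt_mul (x := x ^ 2 * y ^ 2) (by positivity), Real.sqrt_mul (x := x ^ 2) (by positivity),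
      Real.sqrt_sq_eq_abs, Real.sqrt_sq_eq_abs, mul_div_assoc]
  have hexp : Real.exp (-(v - 0) ^ 2 / (2 * (ratioNum a b θ x / (x ^ 2 * y ^ 2 * (1 - θ ^ 2)))))
      * Real.exp (-((x * y) ^ 2 + 2 * θ * (x * y) * y + y ^ 2) / 2)
      = Real.exp (-(ratioDen a b θ θ v x / ratioNum a b θ x * y ^ 2) / 2) := by
    rw [← Real.exp_add]
    congr 1
    unfold ratioDen
    field_simp
    ring
  rw [mixVariance_ratio a b θ hx hx0 hy, gaussianPDFReal, normalDensity,
    Real.coe_toNNReal _ (by positivity), hsq, ← hexp]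
  have h1 : 0 < |x| := abs_pos.2 hx0
  have h2 : 0 < |y| := abs_pos.2 hy
  have h3 := Real.mul_self_sqrt hd.le
  have h4 : 0 < Real.sqrt (1 - θ ^ 2) := by positivity
  have h5 := abs_mul_abs_self y
  have h6 : 0 < Real.sqrt (ratioNum a b θ x) := by positivity
  have h7 : 0 < Real.sqrt (2 * Real.pi) := by positivity
  generalize Real.exp (-(v - 0) ^ 2 / (2 * (ratioNum a b θ x / (x ^ 2 * y ^ 2 * (1 - θ ^ 2)))))
    = E1
  simp only
  generalize Real.exp (-((x * y) ^ 2 + 2 * θ * (x * y) * y + y ^ 2) / 2) = E2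
  generalize Real.sqrt (1 - θ ^ 2) = r at *
  rw [show y ^ 2 = |y| * |y| by rw [h5]; ring, ← h3]
  field_simp

lemma lintegral_abs_mul_mixIntegrand (ha : 0 ≤ a) (hb : 0 ≤ b) (hab : 0 < a + b)
    (hθ : θ ∈ Ioo (-1 : ℝ) 1) (v : ℝ) {x : ℝ} (hx : x ^ 2 ≤ 1) (hx0 : x ≠ 0) :
    ∫⁻ y : ℝ, ENNReal.ofReal |y| * ENNReal.ofReal
        (gaussianPDFReal 0 (Real.toNNReal (mixVariance a b θ (x * y, y))) v
          * normalDensity θ (x * y, y))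
      = ENNReal.ofReal ((1 - θ ^ 2) / (2 * Real.pi) * (|x| * ratioNum a b θ x
        / (ratioDen a b θ θ v x * Real.sqrt (ratioDen a b θ θ v x)))) := by
  have hd := one_sub_sq_pos hθ
  have hN := ratioNum_pos ha hb hab hθ hx hx0
  have hD : 0 < ratioDen a b θ θ v x :=
    lt_of_lt_of_le (by positivity) (ratioDen_ge (v := v) rfl hθ hN.le)
  have h0 : ∀ᵐ y : ℝ, y ≠ 0 := by simp [ae_iff]
  have hC : 0 ≤ (1 - θ ^ 2) * |x| /
      (2 * Real.pi * (Real.sqrt (2 * Real.pi) * Real.sqrt (ratioNum a b θ x))) := by positivity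
  calc _ = ∫⁻ y : ℝ, ENNReal.ofReal ((1 - θ ^ 2) * |x| /
        (2 * Real.pi * (Real.sqrt (2 * Real.pi) * Real.sqrt (ratioNum a b θ x)))) *
        ENNReal.ofReal (y ^ 2 *
          Real.exp (-(ratioDen a b θ θ v x / ratioNum a b θ x * y ^ 2) / 2)) := by
        refine lintegral_congr_ae ?_
        filter_upwards [h0] with y hy
        rw [← ENNReal.ofReal_mul (abs_nonneg y), abs_mul_mixIntegrand ha hb hab hθ v hx hx0 hy,
          ENNReal.ofReal_mul hC]
    _ = _ := by
        rw [lintegral_const_mul _ (by fun_prop), lintegral_sq_mul_exp (div_pos hD hN),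
          ← ENNReal.ofReal_mul hC, Real.sqrt_div hD.le]
        congr 1
        have h3 : 0 < Real.sqrt (ratioNum a b θ x) := by positivity
        have h4 : 0 < Real.sqrt (ratioDen a b θ θ v x) := by positivity
        have h7 : 0 < Real.sqrt (2 * Real.pi) := by positivity
        field_simp

/-- Reflecting x ↦ -x changes only the sign of the cross term. This is why η is kept separate from θ
in `ratioDen`. -/
lemma abs_ratioKernel_neg (a b θ v : ℝ) {x : ℝ} (hx : 0 ≤ x) :
    |-x| * ratioNum a b θ (-x) / (ratioDen a b θ θ v (-x) * Real.sqrt (ratioDen a b θ θ v (-x)))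
      = ratioKernel a b θ (-θ) v x := by
  have h1 : ratioNum a b θ (-x) = ratioNum a b θ x := by simp [ratioNum]
  have h2 : ratioDen a b θ θ v (-x) = ratioDen a b θ (-θ) v x := by
    unfold ratioDen
    rw [h1]
    ring
  rw [h1, h2, abs_neg, abs_of_nonneg hx, ratioKernel]

lemma abs_ratioKernel_of_nonneg (a b θ v : ℝ) {x : ℝ} (hx : 0 ≤ x) :
    |x| * ratioNum a b θ x / (ratioDen a b θ θ v x * Real.sqrt (ratioDen a b θ θ v x))
      = ratioKernel a b θ θ v x := by
  rw [abs_of_nonneg hx, ratioKernel]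

lemma lintegral_abs_ratioKernel (ha : 0 ≤ a) (hb : 0 ≤ b) (hab : 0 < a + b)
    (hθ : θ ∈ Ioo (-1 : ℝ) 1) (v : ℝ) :
    ∫⁻ x in Ioc (-1 : ℝ) 1, ENNReal.ofReal ((1 - θ ^ 2) / (2 * Real.pi) * (|x| * ratioNum a b θ x
        / (ratioDen a b θ θ v x * Real.sqrt (ratioDen a b θ θ v x))))
      = ENNReal.ofReal (halfDensity a b θ v) := by
  have hd := one_sub_sq_pos hθ
  set f : ℝ → ℝ := fun x => |x| * ratioNum a b θ x
        / (ratioDen a b θ θ v x * Real.sqrt (ratioDen a b θ θ v x)) with hf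
  have hneg : ∀ x, 0 ≤ x → f (-x) = ratioKernel a b θ (-θ) v x := fun x hx =>
    abs_ratioKernel_neg a b θ v hx
  have hpos : ∀ x, 0 ≤ x → f x = ratioKernel a b θ θ v x := fun x hx =>
    abs_ratioKernel_of_nonneg a b θ v hx
  set C := 1 / ((1 - θ ^ 2) * Real.sqrt (1 - θ ^ 2)
      * Real.sqrt (a ^ 2 + (b ^ 2 - 2 * a * b * θ))) with hC
  have hbd : ∀ x ∈ Icc (-1 : ℝ) 1, 0 ≤ f x ∧ f x ≤ C := fun x hx => by
    rcases le_total 0 x with h | h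
    · rw [hpos x h]
      exact ⟨ratioKernel_nonneg ha hb hab hθ rfl ⟨h, hx.2⟩,
        ratioKernel_le ha hb hab hθ rfl ⟨h, hx.2⟩⟩
    · have hx' : -x ∈ Icc (0 : ℝ) 1 := ⟨by linarith, by linarith [hx.1]⟩
      have := hneg (-x) hx'.1
      rw [neg_neg] at this
      rw [this]
      exact ⟨ratioKernel_nonneg ha hb hab hθ (neg_sq θ) hx',
        ratioKernel_le ha hb hab hθ (neg_sq θ) hx'⟩
  have hfm : Measurable f := by
    rw [hf]
    unfold ratioDen ratioNum
    fun_prop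
  have hint : IntegrableOn f (Icc (-1 : ℝ) 1) := by
    refine Measure.integrableOn_of_bounded (M := C) (by simp) hfm.aestronglyMeasurable ?_
    refine (ae_restrict_iff' measurableSet_Icc).2 (ae_of_all _ fun x hx => ?_)
    rw [Real.norm_of_nonneg (hbd x hx).1]
    exact (hbd x hx).2
  have hintc : IntegrableOn f (Ioc (-1 : ℝ) 1) := hint.mono_set Ioc_subset_Icc_self
  have hii : ∀ c d : ℝ, c ∈ Icc (-1 : ℝ) 1 → d ∈ Icc (-1 : ℝ) 1 →
      IntervalIntegrable f volume c d := fun c d hc hd => by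
    rw [intervalIntegrable_iff]
    exact hint.mono_set (uIoc_subset_uIcc.trans (uIcc_subset_Icc hc hd))
  rw [← ofReal_integral_eq_lintegral_ofReal (hintc.const_mul _)]
  · congr 1
    rw [integral_const_mul, halfDensity, ← intervalIntegral.integral_of_le (by norm_num),
      ← intervalIntegral.integral_add_adjacent_intervals
        (hii (-1) 0 (by norm_num) (by norm_num)) (hii 0 1 (by norm_num) (by norm_num)),
      intervalIntegral.integral_add (intervalIntegrable_ratioKernel ha hb hab hθ v rfl)
        (intervalIntegrable_ratioKernel ha hb hab hθ v (neg_sq θ)), add_comm]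
    congr 2
    · refine intervalIntegral.integral_congr fun x hx => ?_
      rw [uIcc_of_le zero_le_one] at hx
      exact hpos x hx.1
    · have h := intervalIntegral.integral_comp_neg (a := 0) (b := 1) f
      rw [neg_zero] at h
      rw [← h]
      refine intervalIntegral.integral_congr fun x hx => ?_
      rw [uIcc_of_le zero_le_one] at hx
      exact hneg x hx.1
  · refine (ae_restrict_iff' measurableSet_Ioc).2 (ae_of_all _ fun x hx => ?_)
    have := (hbd x (Ioc_subset_Icc_self hx)).1
    exact mul_nonneg (by positivity) this

lemma measurable_mixIntegrand_right (a b θ v : ℝ) : Measurable fun y : ℝ × ℝ =>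
    gaussianPDFReal 0 (Real.toNNReal (mixVariance a b θ y)) v * normalDensity θ y := by
  have h : Measurable fun y : ℝ × ℝ => (v, y) := measurable_prodMk_left
  simpa only [Function.comp_def] using (measurable_mixIntegrand a b θ).comp h

/-- Both regions are needed: the coordinate swap carries the complement of the strict one to the
non-strict one. -/
lemma setLIntegral_mixIntegrand (ha : 0 ≤ a) (hb : 0 ≤ b) (hab : 0 < a + b)
    (hθ : θ ∈ Ioo (-1 : ℝ) 1) (v : ℝ) :
    ∫⁻ y in {y : ℝ × ℝ | |y.1| < |y.2|}, ENNReal.ofReal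
        (gaussianPDFReal 0 (Real.toNNReal (mixVariance a b θ y)) v * normalDensity θ y)
      = ENNReal.ofReal (halfDensity a b θ v) ∧
    ∫⁻ y in {y : ℝ × ℝ | |y.1| ≤ |y.2|}, ENNReal.ofReal
        (gaussianPDFReal 0 (Real.toNNReal (mixVariance a b θ y)) v * normalDensity θ y)
      = ENNReal.ofReal (halfDensity a b θ v) := by
  have hm : Measurable fun y : ℝ × ℝ => ENNReal.ofReal
      (gaussianPDFReal 0 (Real.toNNReal (mixVariance a b θ y)) v * normalDensity θ y) :=
    (measurable_mixIntegrand_right a b θ v).ennreal_ofReal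
  have key : ∀ S : Set ℝ, MeasurableSet S → S =ᵐ[volume] Ioc (-1 : ℝ) 1 →
      ∫⁻ y in {y : ℝ × ℝ | y.1 / y.2 ∈ S}, ENNReal.ofReal
        (gaussianPDFReal 0 (Real.toNNReal (mixVariance a b θ y)) v * normalDensity θ y)
      = ENNReal.ofReal (halfDensity a b θ v) := fun S hS hSe => by
    rw [lintegral_preimage_div hS hm, setLIntegral_congr hSe,
      ← lintegral_abs_ratioKernel ha hb hab hθ v]
    have h0 : ∀ᵐ x : ℝ, x ≠ 0 := by simp [ae_iff]
    refine setLIntegral_congr_fun_ae measurableSet_Ioc ?_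
    filter_upwards [h0] with x hx hxI
    exact lintegral_abs_mul_mixIntegrand ha hb hab hθ v (by nlinarith [hxI.1, hxI.2]) hx
  constructor
  · rw [← key (Ioo (-1) 1) measurableSet_Ioo Ioo_ae_eq_Ioc]
    refine setLIntegral_congr ?_
    filter_upwards [ae_volume_ne_zero] with y hy
    refine propext ?_
    change |y.1| < |y.2| ↔ y.1 / y.2 ∈ Ioo (-1 : ℝ) 1
    rw [mem_Ioo, ← abs_lt, abs_div, div_lt_one (abs_pos.2 hy.2)]
  · rw [← key (Icc (-1) 1) measurableSet_Icc Ioc_ae_eq_Icc.symm]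
    refine setLIntegral_congr ?_
    filter_upwards [ae_volume_ne_zero] with y hy
    refine propext ?_
    change |y.1| ≤ |y.2| ↔ y.1 / y.2 ∈ Icc (-1 : ℝ) 1
    rw [mem_Icc, ← abs_le, abs_div, div_le_one (abs_pos.2 hy.2)]

lemma mixVariance_swap (a b θ : ℝ) (y : ℝ × ℝ) :
    mixVariance a b θ y.swap = mixVariance b a θ y := by
  simp only [mixVariance, Prod.fst_swap, Prod.snd_swap, max_comm (y.2 ^ 2)]
  ring

lemma normalDensity_swap (θ : ℝ) (y : ℝ × ℝ) : normalDensity θ y.swap = normalDensity θ y := by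
  simp only [normalDensity, Prod.fst_swap, Prod.snd_swap]
  congr 3
  ring

lemma halfDensity_nonneg (ha : 0 ≤ a) (hb : 0 ≤ b) (hab : 0 < a + b) (hθ : θ ∈ Ioo (-1 : ℝ) 1)
    (v : ℝ) : 0 ≤ halfDensity a b θ v := by
  have hd := one_sub_sq_pos hθ
  refine mul_nonneg (by positivity) (intervalIntegral.integral_nonneg zero_le_one fun x hx => ?_)
  exact add_nonneg (ratioKernel_nonneg ha hb hab hθ rfl hx)
    (ratioKernel_nonneg ha hb hab hθ (neg_sq θ) hx)

lemma mixDensity_eq (ha : 0 ≤ a) (hb : 0 ≤ b) (hab : 0 < a + b) (hθ : θ ∈ Ioo (-1 : ℝ) 1)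
    (v : ℝ) : mixDensity a b θ v = halfDensity a b θ v + halfDensity b a θ v := by
  set φ : ℝ → ℝ → ℝ × ℝ → ENNReal := fun a b y => ENNReal.ofReal
      (gaussianPDFReal 0 (Real.toNNReal (mixVariance a b θ y)) v * normalDensity θ y) with hφ
  have hT : MeasurableSet {y : ℝ × ℝ | |y.1| < |y.2|} :=
    measurableSet_lt continuous_fst.abs.measurable continuous_snd.abs.measurable
  have hT' : MeasurableSet {y : ℝ × ℝ | |y.1| ≤ |y.2|} :=
    measurableSet_le continuous_fst.abs.measurable continuous_snd.abs.measurable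
  have hφs : ∀ y, φ a b y.swap = φ b a y := fun y => by
    simp only [hφ, mixVariance_swap, normalDensity_swap]
  have hφi : ∫⁻ y, ENNReal.ofReal (gaussianPDFReal 0 (Real.toNNReal (mixVariance a b θ y)) v
    * normalDensity θ y) = ∫⁻ y, φ a b y := rfl
  have h1 : ∫⁻ y in {y : ℝ × ℝ | |y.1| < |y.2|}, φ a b y = ENNReal.ofReal (halfDensity a b θ v) :=
    (setLIntegral_mixIntegrand ha hb hab hθ v).1
  have h3 : ∫⁻ y in {y : ℝ × ℝ | |y.1| ≤ |y.2|}, φ b a y = ENNReal.ofReal (halfDensity b a θ v) :=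
    (setLIntegral_mixIntegrand hb ha (by linarith) hθ v).2
  clear_value φ
  have h2 : ∫⁻ y in {y : ℝ × ℝ | |y.1| < |y.2|}ᶜ, φ a b y
      = ENNReal.ofReal (halfDensity b a θ v) := by
    rw [← h3, ← lintegral_indicator hT.compl, ← lintegral_indicator hT', Measure.volume_eq_prod,
      ← lintegral_prod_swap]
    refine lintegral_congr fun y => ?_
    by_cases h : |y.1| ≤ |y.2|
    · rw [indicator_of_mem (by simpa using h), indicator_of_mem (by simpa using h), hφs y]
    · rw [indicator_of_notMem (by simpa using h), indicator_of_notMem (by simpa using h)]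
  have hsum : ∫⁻ y, φ a b y = ENNReal.ofReal (halfDensity a b θ v + halfDensity b a θ v) := by
    rw [← lintegral_add_compl _ hT, h1, h2, ENNReal.ofReal_add
      (halfDensity_nonneg ha hb hab hθ v) (halfDensity_nonneg hb ha (by linarith) hθ v)]
  rw [mixDensity, integral_eq_lintegral_of_nonneg_ae
    (ae_of_all _ fun y => mul_nonneg (gaussianPDFReal_nonneg _ _ _) (normalDensity_nonneg θ y))
    (measurable_mixIntegrand_right a b θ v).aestronglyMeasurable]
  rw [hφi, hsum, ENNReal.toReal_ofReal
    (add_nonneg (halfDensity_nonneg ha hb hab hθ v) (halfDensity_nonneg hb ha (by linarith) hθ v))]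

/-! ### The tail of the mixture density -/

/-- An antiderivative is -1/(d√(A + du²)). The integral is used both for the limit (A = a²) and for
the dominating function. -/
lemma integrableOn_and_integral_tail {A d : ℝ} (hA : 0 < A) (hd : 0 < d) :
    IntegrableOn (fun u : ℝ => u / ((A + d * u ^ 2) * Real.sqrt (A + d * u ^ 2))) (Ioi 0) ∧
    ∫ u in Ioi (0 : ℝ), u / ((A + d * u ^ 2) * Real.sqrt (A + d * u ^ 2))
      = 1 / (d * Real.sqrt A) := by
  have hpos : ∀ u : ℝ, 0 < A + d * u ^ 2 := fun u => by positivity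
  have hderiv : ∀ u ∈ Ici (0 : ℝ), HasDerivAt (fun u : ℝ => -(d * Real.sqrt (A + d * u ^ 2))⁻¹)
      (u / ((A + d * u ^ 2) * Real.sqrt (A + d * u ^ 2))) u := fun u _ => by
    have h1 : HasDerivAt (fun u : ℝ => A + d * u ^ 2) (d * (2 * u)) u := by
      simpa using ((hasDerivAt_pow 2 u).const_mul d).const_add A
    have hs : 0 < Real.sqrt (A + d * u ^ 2) := Real.sqrt_pos.2 (hpos u)
    have h2 := (((h1.sqrt (hpos u).ne').const_mul d).inv (by positivity)).neg
    have hval : u / ((A + d * u ^ 2) * Real.sqrt (A + d * u ^ 2))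
        = -(-(d * (d * (2 * u) / (2 * Real.sqrt (A + d * u ^ 2))))
          / (d * Real.sqrt (A + d * u ^ 2)) ^ 2) := by
      rw [mul_pow, Real.sq_sqrt (hpos u).le]
      have := (hpos u).ne'
      field_simp
    rw [hval]
    exact h2
  have hnn : ∀ u ∈ Ioi (0 : ℝ), 0 ≤ u / ((A + d * u ^ 2) * Real.sqrt (A + d * u ^ 2)) :=
    fun u hu => by
      have := hpos u
      have : 0 < u := hu
      positivity
  have hlim : Tendsto (fun u : ℝ => -(d * Real.sqrt (A + d * u ^ 2))⁻¹) atTop (𝓝 0) := by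
    have h1 : Tendsto (fun u : ℝ => A + d * u ^ 2) atTop atTop :=
      tendsto_atTop_add_const_left _ _ ((tendsto_pow_atTop two_ne_zero).const_mul_atTop hd)
    have h2 := ((Real.tendsto_sqrt_atTop.comp h1).const_mul_atTop hd).inv_tendsto_atTop.neg
    simpa using h2
  refine ⟨integrableOn_Ioi_deriv_of_nonneg' hderiv hnn hlim, ?_⟩
  rw [integral_Ioi_of_hasDerivAt_of_nonneg' hderiv hnn hlim]
  simp

/-- The expression is affine in x² ∈ [0, 1], so it is at least the smaller endpoint value; a > 0
makes both endpoint values positive. -/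
lemma exists_ratioNum_bounds (ha : 0 < a) (hb : 0 ≤ b) (hθ : θ ∈ Ioo (-1 : ℝ) 1) :
    ∃ m M : ℝ, 0 < m ∧ 0 ≤ M ∧ ∀ x : ℝ, x ^ 2 ≤ 1 →
      m ≤ ratioNum a b θ x ∧ ratioNum a b θ x ≤ M := by
  have h1 := one_sub_sq_add_pos ha.le hb (by linarith) hθ
  set c := b ^ 2 - 2 * a * b * θ with hc
  refine ⟨min (a ^ 2) (a ^ 2 + c), a ^ 2 + |c|, lt_min (by positivity) h1, by positivity,
    fun x hx => ?_⟩
  have hx0 := sq_nonneg x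
  unfold ratioNum
  rw [← hc]
  constructor
  · rcases le_total 0 c with h | h
    · exact (min_le_left _ _).trans (by nlinarith)
    · exact (min_le_right _ _).trans (by nlinarith)
  · have := le_abs_self c
    have := abs_nonneg c
    nlinarith

lemma mul_ratioKernel_div (a b θ η : ℝ) {v : ℝ} (hv : v ≠ 0) (u : ℝ) :
    v * ratioKernel a b θ η v (u / v) = u * ratioNum a b θ (u / v) /
      ((((u / v) ^ 2 + 2 * η * (u / v) + 1) * ratioNum a b θ (u / v) + (1 - θ ^ 2) * u ^ 2) *
        Real.sqrt (((u / v) ^ 2 + 2 * η * (u / v) + 1) * ratioNum a b θ (u / v)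
          + (1 - θ ^ 2) * u ^ 2)) := by
  have hD : ratioDen a b θ η v (u / v)
      = ((u / v) ^ 2 + 2 * η * (u / v) + 1) * ratioNum a b θ (u / v) + (1 - θ ^ 2) * u ^ 2 := by
    unfold ratioDen
    congr 1
    field_simp
  rw [ratioKernel, hD, ← mul_div_assoc]
  congr 1
  field_simp

lemma sq_mul_integral_ratioKernel (a b θ η : ℝ) {v : ℝ} (hv : 0 < v) :
    v ^ 2 * ∫ x in (0 : ℝ)..1, ratioKernel a b θ η v x
      = ∫ u in Ioi (0 : ℝ), (Iic v).indicator (fun u => v * ratioKernel a b θ η v (u / v)) u := by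
  rw [setIntegral_indicator measurableSet_Iic, Ioi_inter_Iic,
    ← intervalIntegral.integral_of_le hv.le, intervalIntegral.integral_const_mul,
    intervalIntegral.integral_comp_div _ hv.ne', zero_div, div_self hv.ne', smul_eq_mul]
  ring

/-- After x = u/v the polynomial factors are evaluated at u/v → 0 and freeze at a² and 1. The limit
is ∫₀^∞ a²u/(a² + (1 - θ²)u²)^{3/2} du. -/
lemma tendsto_sq_mul_integral_ratioKernel (ha : 0 < a) (hb : 0 ≤ b) (hθ : θ ∈ Ioo (-1 : ℝ) 1)
    {η : ℝ} (hη : η ^ 2 = θ ^ 2) :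
    Tendsto (fun v : ℝ => v ^ 2 * ∫ x in (0 : ℝ)..1, ratioKernel a b θ η v x) atTop
      (𝓝 (a / (1 - θ ^ 2))) := by
  have hd := one_sub_sq_pos hθ
  obtain ⟨m, M, hm, hM, hbd⟩ := exists_ratioNum_bounds ha hb hθ
  have hκ : 0 < (1 - θ ^ 2) * m := by positivity
  have hlimit : ∫ u in Ioi (0 : ℝ), a ^ 2 *
      (u / ((a ^ 2 + (1 - θ ^ 2) * u ^ 2) * Real.sqrt (a ^ 2 + (1 - θ ^ 2) * u ^ 2)))
      = a / (1 - θ ^ 2) := by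
    rw [integral_const_mul, (integrableOn_and_integral_tail (by positivity) hd).2,
      Real.sqrt_sq ha.le]
    field_simp
  have heq : ∀ᶠ v : ℝ in atTop,
      ∫ u in Ioi (0 : ℝ), (Iic v).indicator (fun u => v * ratioKernel a b θ η v (u / v)) u
      = v ^ 2 * ∫ x in (0 : ℝ)..1, ratioKernel a b θ η v x := by
    filter_upwards [eventually_gt_atTop 0] with v hv
    exact (sq_mul_integral_ratioKernel a b θ η hv).symm
  rw [← hlimit]
  refine Tendsto.congr' heq ?_
  refine tendsto_integral_filter_of_dominated_convergence
    -- The numerator factor N is replaced by its upper bound M, and the product of the quadratic and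
    -- N by its lower bound (1 - θ²)m.
    (fun u => M * (u / (((1 - θ ^ 2) * m + (1 - θ ^ 2) * u ^ 2) *
      Real.sqrt ((1 - θ ^ 2) * m + (1 - θ ^ 2) * u ^ 2)))) ?_ ?_
    ((integrableOn_and_integral_tail hκ hd).1.const_mul M) ?_
  · refine Eventually.of_forall fun v => ?_
    have h := measurable_ratioKernel a b θ η v
    exact (Measurable.indicator (by fun_prop) measurableSet_Iic).aestronglyMeasurable
  · filter_upwards [eventually_gt_atTop 0] with v hv
    refine (ae_restrict_iff' measurableSet_Ioi).2 (ae_of_all _ fun u hu => ?_)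
    have hu0 : 0 < u := hu
    by_cases huv : u ≤ v
    · rw [indicator_of_mem (show u ∈ Iic v from huv), mul_ratioKernel_div a b θ η hv.ne']
      have hx : (u / v) ^ 2 ≤ 1 := by
        have h1 : u / v ≤ 1 := (div_le_one hv).2 huv
        have h0 : 0 ≤ u / v := by positivity
        nlinarith
      obtain ⟨l1, l2⟩ := hbd _ hx
      have hq := quadratic_ge η (u / v)
      rw [hη] at hq
      set N := ratioNum a b θ (u / v)
      set q := (u / v) ^ 2 + 2 * η * (u / v) + 1
      have hN : 0 < N := hm.trans_le l1
      have hqN : (1 - θ ^ 2) * m ≤ q * N := mul_le_mul hq l1 hm.le (hd.le.trans hq)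
      have hq0 : 0 < q := hd.trans_le hq
      rw [Real.norm_of_nonneg (by positivity), mul_comm u N, mul_div_assoc]
      gcongr
    · rw [indicator_of_notMem (show u ∉ Iic v from huv), norm_zero]
      positivity
  · refine (ae_restrict_iff' measurableSet_Ioi).2 (ae_of_all _ fun u hu => ?_)
    have hu0 : 0 < u := hu
    have hcont : ContinuousAt (fun x : ℝ => u * ratioNum a b θ x /
      (((x ^ 2 + 2 * η * x + 1) * ratioNum a b θ x + (1 - θ ^ 2) * u ^ 2) *
        Real.sqrt ((x ^ 2 + 2 * η * x + 1) * ratioNum a b θ x + (1 - θ ^ 2) * u ^ 2))) 0 := by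
      refine ContinuousAt.div ?_ ?_ ?_
      · unfold ratioNum
        fun_prop
      · unfold ratioNum
        fun_prop
      · have h0 : ((0 : ℝ) ^ 2 + 2 * η * 0 + 1) * ratioNum a b θ 0 + (1 - θ ^ 2) * u ^ 2
            = a ^ 2 + (1 - θ ^ 2) * u ^ 2 := by
          simp [ratioNum]
        rw [h0]
        positivity
    have ht := hcont.tendsto.comp
      (tendsto_const_nhds.div_atTop tendsto_id : Tendsto (fun v : ℝ => u / v) atTop (𝓝 0))
    have hval : u * ratioNum a b θ 0 /
      ((((0 : ℝ) ^ 2 + 2 * η * 0 + 1) * ratioNum a b θ 0 + (1 - θ ^ 2) * u ^ 2) *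
        Real.sqrt (((0 : ℝ) ^ 2 + 2 * η * 0 + 1) * ratioNum a b θ 0 + (1 - θ ^ 2) * u ^ 2))
      = a ^ 2 *
      (u / ((a ^ 2 + (1 - θ ^ 2) * u ^ 2) * Real.sqrt (a ^ 2 + (1 - θ ^ 2) * u ^ 2))) := by
      simp only [ratioNum]
      norm_num
      ring
    rw [hval] at ht
    refine ht.congr' ?_
    filter_upwards [eventually_ge_atTop u] with v hv
    rw [indicator_of_mem (show u ∈ Iic v from hv),
      mul_ratioKernel_div a b θ η (hu0.trans_le hv).ne']
    rfl

lemma tendsto_sq_mul_halfDensity_of_pos (ha : 0 < a) (hb : 0 ≤ b) (hθ : θ ∈ Ioo (-1 : ℝ) 1) :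
    Tendsto (fun v : ℝ => v ^ 2 * halfDensity a b θ v) atTop (𝓝 (a / Real.pi)) := by
  have hd := one_sub_sq_pos hθ
  have h := ((tendsto_sq_mul_integral_ratioKernel ha hb hθ (η := θ) rfl).add
    (tendsto_sq_mul_integral_ratioKernel ha hb hθ (neg_sq θ))).const_mul
      ((1 - θ ^ 2) / (2 * Real.pi))
  have hval : (1 - θ ^ 2) / (2 * Real.pi) * (a / (1 - θ ^ 2) + a / (1 - θ ^ 2))
      = a / Real.pi := by
    field_simp
    ring
  rw [hval] at h
  refine h.congr fun v => ?_
  rw [halfDensity, intervalIntegral.integral_add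
    (intervalIntegrable_ratioKernel ha.le hb (by linarith) hθ v rfl)
    (intervalIntegrable_ratioKernel ha.le hb (by linarith) hθ v (neg_sq θ))]
  ring

/-- For a = 0 the scaling argument lacks its lower bound m, but N = b²x² cancels against the v²x²
term of D, leaving decay of order v⁻³. -/
lemma ratioKernel_zero_le (hb : 0 < b) (hθ : θ ∈ Ioo (-1 : ℝ) 1) {η v x : ℝ}
    (hη : η ^ 2 = θ ^ 2) (hv : 0 < v) (hx : 0 ≤ x) :
    ratioKernel 0 b θ η v x
      ≤ b ^ 2 / ((1 - θ ^ 2) * Real.sqrt (1 - θ ^ 2)) / v ^ 3 := by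
  have hd := one_sub_sq_pos hθ
  rcases hx.eq_or_lt with rfl | hx
  · simp only [ratioKernel, zero_mul, zero_div]
    positivity
  have hN : ratioNum 0 b θ x = b ^ 2 * x ^ 2 := by simp [ratioNum]
  have hq := quadratic_ge η x
  rw [hη] at hq
  have hq0 : 0 < x ^ 2 + 2 * η * x + 1 := hd.trans_le hq
  have hD : (v * x) ^ 2 * (1 - θ ^ 2) ≤ ratioDen 0 b θ η v x := by
    rw [ratioDen, hN]
    have : 0 ≤ (x ^ 2 + 2 * η * x + 1) * (b ^ 2 * x ^ 2) := by positivity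
    linarith
  have hs : v * x * Real.sqrt (1 - θ ^ 2) ≤ Real.sqrt (ratioDen 0 b θ η v x) := by
    have h := Real.sqrt_le_sqrt hD
    rwa [Real.sqrt_mul (by positivity), Real.sqrt_sq (by positivity)] at h
  have hD0 : 0 ≤ ratioDen 0 b θ η v x := le_trans (by positivity) hD
  calc ratioKernel 0 b θ η v x
      ≤ x * (b ^ 2 * x ^ 2) / ((v * x) ^ 2 * (1 - θ ^ 2) * (v * x * Real.sqrt (1 - θ ^ 2))) := by
        rw [ratioKernel, hN]
        gcongr
    _ = _ := by
        field_simp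

lemma tendsto_sq_mul_halfDensity_zero (hb : 0 < b) (hθ : θ ∈ Ioo (-1 : ℝ) 1) :
    Tendsto (fun v : ℝ => v ^ 2 * halfDensity 0 b θ v) atTop (𝓝 0) := by
  have hd := one_sub_sq_pos hθ
  set C := b ^ 2 / ((1 - θ ^ 2) * Real.sqrt (1 - θ ^ 2)) with hC
  have hup : Tendsto (fun v : ℝ => (1 - θ ^ 2) / (2 * Real.pi) * (2 * C) / v) atTop (𝓝 0) :=
    tendsto_const_nhds.div_atTop tendsto_id
  refine squeeze_zero' ?_ ?_ hup
  · refine Eventually.of_forall fun v => mul_nonneg (sq_nonneg v) ?_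
    exact halfDensity_nonneg le_rfl hb.le (by linarith) hθ v
  · filter_upwards [eventually_gt_atTop 0] with v hv
    have hI : ∫ x in (0 : ℝ)..1, (ratioKernel 0 b θ θ v x + ratioKernel 0 b θ (-θ) v x)
        ≤ ∫ _x in (0 : ℝ)..1, 2 * C / v ^ 3 := by
      refine intervalIntegral.integral_mono_on zero_le_one
        ((intervalIntegrable_ratioKernel le_rfl hb.le (by linarith) hθ v rfl).add
        (intervalIntegrable_ratioKernel le_rfl hb.le (by linarith) hθ v (neg_sq θ)))
        intervalIntegrable_const fun x hx => ?_
      have h1 := ratioKernel_zero_le hb hθ (η := θ) rfl hv hx.1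
      have h2 := ratioKernel_zero_le hb hθ (neg_sq θ) hv hx.1
      rw [← hC] at h1 h2
      rw [mul_div_assoc]
      linarith
    rw [intervalIntegral.integral_const, sub_zero, one_smul] at hI
    calc v ^ 2 * halfDensity 0 b θ v
        ≤ v ^ 2 * ((1 - θ ^ 2) / (2 * Real.pi) * (2 * C / v ^ 3)) := by
          unfold halfDensity
          gcongr
      _ = _ := by
          field_simp

lemma tendsto_sq_mul_halfDensity (ha : 0 ≤ a) (hb : 0 ≤ b) (hab : 0 < a + b)
    (hθ : θ ∈ Ioo (-1 : ℝ) 1) :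
    Tendsto (fun v : ℝ => v ^ 2 * halfDensity a b θ v) atTop (𝓝 (a / Real.pi)) := by
  rcases ha.eq_or_lt with rfl | h
  · rw [zero_div]
    exact tendsto_sq_mul_halfDensity_zero (by linarith) hθ
  · exact tendsto_sq_mul_halfDensity_of_pos h hb hθ

lemma tendsto_sq_mul_mixDensity (ha : 0 ≤ a) (hb : 0 ≤ b) (hab : 0 < a + b)
    (hθ : θ ∈ Ioo (-1 : ℝ) 1) :
    Tendsto (fun v : ℝ => v ^ 2 * mixDensity a b θ v) atTop (𝓝 ((a + b) / Real.pi)) := by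
  have h := (tendsto_sq_mul_halfDensity ha hb hab hθ).add
    (tendsto_sq_mul_halfDensity hb ha (by linarith) hθ)
  rw [← add_div] at h
  refine h.congr fun v => ?_
  rw [mixDensity_eq ha hb hab hθ]
  ring

/-! ### Continuity of the mixture density -/

lemma continuous_halfDensity (ha : 0 ≤ a) (hb : 0 ≤ b) (hab : 0 < a + b)
    (hθ : θ ∈ Ioo (-1 : ℝ) 1) : Continuous (halfDensity a b θ) := by
  have hd := one_sub_sq_pos hθ
  have key : ∀ η : ℝ, η ^ 2 = θ ^ 2 →
      Continuous fun v => ∫ x in (0 : ℝ)..1, ratioKernel a b θ η v x := fun η hη => by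
    refine intervalIntegral.continuous_of_dominated_interval
      (bound := fun _ => 1 / ((1 - θ ^ 2) * Real.sqrt (1 - θ ^ 2)
      * Real.sqrt (a ^ 2 + (b ^ 2 - 2 * a * b * θ)))) (fun v =>
      (measurable_ratioKernel a b θ η v).aestronglyMeasurable) (fun v => ae_of_all _ fun x hx => ?_)
      intervalIntegrable_const (ae_of_all _ fun x hx => ?_)
    · rw [uIoc_of_le zero_le_one] at hx
      rw [Real.norm_of_nonneg (ratioKernel_nonneg ha hb hab hθ hη (Ioc_subset_Icc_self hx))]
      exact ratioKernel_le ha hb hab hθ hη (Ioc_subset_Icc_self hx)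
    · rw [uIoc_of_le zero_le_one] at hx
      have hN := ratioNum_pos ha hb hab hθ (x := x) (by nlinarith [hx.1, hx.2]) hx.1.ne'
      have hD : ∀ v, 0 < ratioDen a b θ η v x := fun v =>
        lt_of_lt_of_le (by positivity) (ratioDen_ge (v := v) hη hθ hN.le)
      have hc : Continuous fun v => ratioDen a b θ η v x := by
        unfold ratioDen
        fun_prop
      unfold ratioKernel
      refine continuous_const.div (hc.mul hc.sqrt) fun v => ?_
      have := hD v
      positivity
  have h := ((key θ rfl).add (key (-θ) (neg_sq θ))).const_mul ((1 - θ ^ 2) / (2 * Real.pi))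
  refine h.congr fun v => ?_
  rw [halfDensity, intervalIntegral.integral_add
    (intervalIntegrable_ratioKernel ha hb hab hθ v rfl)
    (intervalIntegrable_ratioKernel ha hb hab hθ v (neg_sq θ))]
  rfl

lemma continuous_mixDensity (ha : 0 ≤ a) (hb : 0 ≤ b) (hab : 0 < a + b)
    (hθ : θ ∈ Ioo (-1 : ℝ) 1) : Continuous (mixDensity a b θ) := by
  have h : mixDensity a b θ = fun v => halfDensity a b θ v + halfDensity b a θ v :=
    funext fun v => mixDensity_eq ha hb hab hθ v
  rw [h]
  exact (continuous_halfDensity ha hb hab hθ).add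
    (continuous_halfDensity hb ha (by linarith) hθ)

/-! ### The value at 0 for independent components -/

lemma ratioKernel_zero (a b x : ℝ) : ratioKernel a b 0 0 0 x =
    x * (a ^ 2 + b ^ 2 * x ^ 2) / ((x ^ 2 + 1) * (a ^ 2 + b ^ 2 * x ^ 2) *
      Real.sqrt ((x ^ 2 + 1) * (a ^ 2 + b ^ 2 * x ^ 2))) := by
  simp [ratioKernel, ratioDen, ratioNum]

lemma integral_ratioKernel_zero {a b : ℝ} (ha : 0 < a) :
    ∫ x in (0 : ℝ)..1, ratioKernel a b 0 0 0 x
      = 1 / (2 * a + Real.sqrt (2 * (a ^ 2 + b ^ 2))) := by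
  have hcont : Continuous (ratioKernel a b 0 0 0) := by
    have h : ratioKernel a b 0 0 0 = fun x => x * (a ^ 2 + b ^ 2 * x ^ 2) /
        ((x ^ 2 + 1) * (a ^ 2 + b ^ 2 * x ^ 2) *
        Real.sqrt ((x ^ 2 + 1) * (a ^ 2 + b ^ 2 * x ^ 2))) := funext fun x => ratioKernel_zero a b x
    rw [h]
    refine Continuous.div (by fun_prop) (by fun_prop) fun x => ?_
    positivity
  -- With p = √(x² + 1) and r = √(a² + b²x²), the natural antiderivative (r/p - a)/(b² - a²) breaks
  -- down at a = b. Rationalizing the numerator gives x²/(p(r + ap)), valid in all cases.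
  have hderiv : ∀ x ∈ uIcc (0 : ℝ) 1, HasDerivAt (fun x : ℝ => x ^ 2 / (Real.sqrt (x ^ 2 + 1) *
      (Real.sqrt (a ^ 2 + b ^ 2 * x ^ 2) + a * Real.sqrt (x ^ 2 + 1))))
      (ratioKernel a b 0 0 0 x) x := fun x _ => by
    have hp0 : 0 < x ^ 2 + 1 := by positivity
    have hr0 : 0 < a ^ 2 + b ^ 2 * x ^ 2 := by positivity
    have h1 : HasDerivAt (fun x : ℝ => x ^ 2 + 1) (2 * x) x := by
      simpa using (hasDerivAt_pow 2 x).add_const 1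
    have h2 : HasDerivAt (fun x : ℝ => a ^ 2 + b ^ 2 * x ^ 2) (b ^ 2 * (2 * x)) x := by
      simpa using ((hasDerivAt_pow 2 x).const_mul (b ^ 2)).const_add (a ^ 2)
    have h3 : HasDerivAt (fun x : ℝ => x ^ 2) (2 * x) x := by simpa using hasDerivAt_pow 2 x
    have hp := h1.sqrt hp0.ne'
    have hr := h2.sqrt hr0.ne'
    have hpp : 0 < Real.sqrt (x ^ 2 + 1) := by positivity
    have hrr : 0 < Real.sqrt (a ^ 2 + b ^ 2 * x ^ 2) := by positivity
    have h := h3.div (hp.mul (hr.add (hp.const_mul a)))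
      (show Real.sqrt (x ^ 2 + 1) * (Real.sqrt (a ^ 2 + b ^ 2 * x ^ 2)
        + a * Real.sqrt (x ^ 2 + 1)) ≠ 0 by positivity)
    refine h.congr_deriv ?_
    rw [ratioKernel_zero, Real.sqrt_mul hp0.le]
    have ep := Real.sq_sqrt hp0.le
    have er := Real.sq_sqrt hr0.le
    simp only [Pi.add_apply, Pi.mul_apply]
    generalize Real.sqrt (x ^ 2 + 1) = p at hpp ep ⊢
    generalize Real.sqrt (a ^ 2 + b ^ 2 * x ^ 2) = r at hrr er ⊢
    rw [← ep, ← er]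
    field_simp
    linear_combination x * (r ^ 2 + 2 * a * p * r) * ep + x * p ^ 2 * er
  rw [intervalIntegral.integral_eq_sub_of_hasDerivAt hderiv (hcont.intervalIntegrable _ _)]
  have h2 : Real.sqrt (2 * (a ^ 2 + b ^ 2)) = Real.sqrt 2 * Real.sqrt (a ^ 2 + b ^ 2) :=
    Real.sqrt_mul zero_le_two _
  have h3 := Real.mul_self_sqrt (zero_le_two (α := ℝ))
  norm_num [h2]
  have : 0 < Real.sqrt 2 := by positivity
  rw [← mul_inv]
  congr 1
  linear_combination a * h3

lemma halfDensity_zero {a b : ℝ} (ha : 0 < a) :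
    halfDensity a b 0 0 = 1 / Real.pi * (1 / (2 * a + Real.sqrt (2 * (a ^ 2 + b ^ 2)))) := by
  rw [← integral_ratioKernel_zero ha, halfDensity, neg_zero]
  simp only [← two_mul]
  rw [intervalIntegral.integral_const_mul]
  have := Real.pi_ne_zero
  field_simp
  ring

lemma halfDensity_add_zero {a b : ℝ} (ha : 0 < a) (hb : 0 < b) (hab : a + b = 1) :
    halfDensity a b 0 0 + halfDensity b a 0 0 = 1 / Real.pi := by
  rw [halfDensity_zero ha, halfDensity_zero hb, add_comm (b ^ 2)]
  have hS := Real.mul_self_sqrt (show 0 ≤ 2 * (a ^ 2 + b ^ 2) by positivity)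
  have hS0 : 0 ≤ Real.sqrt (2 * (a ^ 2 + b ^ 2)) := Real.sqrt_nonneg _
  generalize Real.sqrt (2 * (a ^ 2 + b ^ 2)) = S at *
  obtain rfl : b = 1 - a := by linarith
  rw [← mul_add]
  -- With b = 1 - a and S² = 2(a² + b²), the common denominator is 4ab + 2S + S² = 2(a + b)² + 2S =
  -- 2 + 2S, which is the numerator.
  have : 1 / (2 * a + S) + 1 / (2 * (1 - a) + S) = 1 := by
    have h1 : 0 < 2 * a + S := by positivity
    have h2 : 0 < 2 * (1 - a) + S := by positivity
    field_simp
    linear_combination -hS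
  rw [this, mul_one]

/-! ### The derivative in θ of the density at 0 -/

/-- The value at `v = 0` of `ratioKernel`, with `η = σ θ`, written with real powers. -/
noncomputable def slopeKernel (a b σ : ℝ) (p : ℝ × ℝ) : ℝ :=
  p.2 * ((p.2 ^ 2 + 2 * (σ * p.1) * p.2 + 1) ^ (-(3 / 2) : ℝ) *
    ratioNum a b p.1 p.2 ^ (-(1 / 2) : ℝ))

/-- The derivative of `slopeKernel` in its first argument. -/
noncomputable def slopeKernelDeriv (a b σ : ℝ) (p : ℝ × ℝ) : ℝ :=
  p.2 * (2 * σ * p.2 * (-(3 / 2)) *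
      (p.2 ^ 2 + 2 * (σ * p.1) * p.2 + 1) ^ (-(3 / 2) - 1 : ℝ) *
      ratioNum a b p.1 p.2 ^ (-(1 / 2) : ℝ) +
    (p.2 ^ 2 + 2 * (σ * p.1) * p.2 + 1) ^ (-(3 / 2) : ℝ) *
      (-(2 * a * b * p.2 ^ 2) * (-(1 / 2)) * ratioNum a b p.1 p.2 ^ (-(1 / 2) - 1 : ℝ)))

section Slope

variable {σ : ℝ}

/-- Here [-1/2, 1/2] is just a convenient compact neighbourhood of 0 inside (-1, 1). Over it and x ∈
[0, 1] the bases of all real powers stay positive, so compactness provides the dominating constant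
for differentiating under the integral. -/
lemma slope_quadratic_pos (hσ : σ ^ 2 = 1) {θ : ℝ} (hθ : θ ∈ Icc (-1 / 2 : ℝ) (1 / 2)) (x : ℝ) :
    0 < x ^ 2 + 2 * (σ * θ) * x + 1 := by
  have h := quadratic_ge (σ * θ) x
  rw [mul_pow, hσ] at h
  nlinarith [hθ.1, hθ.2]

lemma slope_ratioNum_pos (ha : 0 < a) (hb : 0 < b) {θ x : ℝ} (hθ : θ ∈ Icc (-1 / 2 : ℝ) (1 / 2))
    (hx : x ∈ Icc (0 : ℝ) 1) : 0 < ratioNum a b θ x := by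
  obtain ⟨m, M, hm, -, h⟩ := exists_ratioNum_bounds (θ := θ) ha hb.le
    ⟨by linarith [hθ.1], by linarith [hθ.2]⟩
  exact hm.trans_le (h x (by nlinarith [hx.1, hx.2])).1

lemma hasDerivAt_slopeKernel (ha : 0 < a) (hb : 0 < b) (hσ : σ ^ 2 = 1) {θ x : ℝ}
    (hθ : θ ∈ Icc (-1 / 2 : ℝ) (1 / 2)) (hx : x ∈ Icc (0 : ℝ) 1) :
    HasDerivAt (fun θ => slopeKernel a b σ (θ, x)) (slopeKernelDeriv a b σ (θ, x)) θ := by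
  have hq := slope_quadratic_pos hσ hθ x
  have hN := slope_ratioNum_pos ha hb hθ hx
  have h1 : HasDerivAt (fun θ : ℝ => x ^ 2 + 2 * (σ * θ) * x + 1) (2 * σ * x) θ := by
    have h := ((((hasDerivAt_id θ).const_mul σ).const_mul 2).mul_const x).const_add (x ^ 2)
    refine (h.add_const 1).congr_deriv ?_
    ring
  have h2 : HasDerivAt (fun θ : ℝ => ratioNum a b θ x) (-(2 * a * b * x ^ 2)) θ := by
    have h := ((((hasDerivAt_id θ).const_mul (2 * a * b)).const_sub (b ^ 2)).mul_const
      (x ^ 2)).const_add (a ^ 2)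
    refine h.congr_deriv ?_
    ring
  exact ((h1.rpow_const (p := -(3 / 2)) (Or.inl hq.ne')).mul
    (h2.rpow_const (p := -(1 / 2)) (Or.inl hN.ne'))).const_mul x

lemma continuousOn_slopeKernel (ha : 0 < a) (hb : 0 < b) (hσ : σ ^ 2 = 1) :
    ContinuousOn (slopeKernel a b σ) (Icc (-1 / 2 : ℝ) (1 / 2) ×ˢ Icc (0 : ℝ) 1) ∧
    ContinuousOn (slopeKernelDeriv a b σ) (Icc (-1 / 2 : ℝ) (1 / 2) ×ˢ Icc (0 : ℝ) 1) := by
  have hq : ∀ r : ℝ, ContinuousOn (fun p : ℝ × ℝ => (p.2 ^ 2 + 2 * (σ * p.1) * p.2 + 1) ^ r)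
      (Icc (-1 / 2 : ℝ) (1 / 2) ×ˢ Icc (0 : ℝ) 1) := fun r =>
    ContinuousOn.rpow_const (by fun_prop) fun p hp =>
      Or.inl (slope_quadratic_pos hσ hp.1 p.2).ne'
  have hN : ∀ r : ℝ, ContinuousOn (fun p : ℝ × ℝ => ratioNum a b p.1 p.2 ^ r)
      (Icc (-1 / 2 : ℝ) (1 / 2) ×ˢ Icc (0 : ℝ) 1) := fun r =>
    ContinuousOn.rpow_const (by unfold ratioNum; fun_prop) fun p hp =>
      Or.inl (slope_ratioNum_pos ha hb hp.1 hp.2).ne'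
  have hx : ContinuousOn (fun p : ℝ × ℝ => p.2) (Icc (-1 / 2 : ℝ) (1 / 2) ×ˢ Icc (0 : ℝ) 1) := by
    fun_prop
  constructor
  · exact hx.mul ((hq _).mul (hN _))
  · exact hx.mul ((((by fun_prop : ContinuousOn (fun p : ℝ × ℝ => 2 * σ * p.2 * (-(3 / 2)))
      _).mul (hq _)).mul (hN _)).add ((hq _).mul ((by fun_prop : ContinuousOn
      (fun p : ℝ × ℝ => -(2 * a * b * p.2 ^ 2) * (-(1 / 2))) _).mul (hN _))))

lemma intervalIntegrable_slopeKernel (ha : 0 < a) (hb : 0 < b) (hσ : σ ^ 2 = 1) {θ : ℝ}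
    (hθ : θ ∈ Icc (-1 / 2 : ℝ) (1 / 2)) :
    IntervalIntegrable (fun x => slopeKernel a b σ (θ, x)) volume 0 1 ∧
    IntervalIntegrable (fun x => slopeKernelDeriv a b σ (θ, x)) volume 0 1 := by
  obtain ⟨h1, h2⟩ := continuousOn_slopeKernel ha hb hσ
  have hc : ContinuousOn (fun x : ℝ => (θ, x)) (uIcc 0 1) := by fun_prop
  have hm : MapsTo (fun x : ℝ => (θ, x)) (uIcc 0 1)
      (Icc (-1 / 2 : ℝ) (1 / 2) ×ˢ Icc (0 : ℝ) 1) := fun x hx => by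
    rw [uIcc_of_le zero_le_one] at hx
    exact ⟨hθ, hx⟩
  exact ⟨(h1.comp hc hm).intervalIntegrable, (h2.comp hc hm).intervalIntegrable⟩

lemma hasDerivAt_integral_slopeKernel (ha : 0 < a) (hb : 0 < b) (hσ : σ ^ 2 = 1) :
    HasDerivAt (fun θ => ∫ x in (0 : ℝ)..1, slopeKernel a b σ (θ, x))
      (∫ x in (0 : ℝ)..1, slopeKernelDeriv a b σ (0, x)) 0 := by
  obtain ⟨C, hC⟩ := (isCompact_Icc.prod isCompact_Icc).exists_bound_of_continuousOn
    (continuousOn_slopeKernel ha hb hσ).2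
  have h0 : (0 : ℝ) ∈ Icc (-1 / 2 : ℝ) (1 / 2) := by norm_num
  refine (intervalIntegral.hasDerivAt_integral_of_dominated_loc_of_deriv_le
    (F := fun θ x => slopeKernel a b σ (θ, x)) (F' := fun θ x => slopeKernelDeriv a b σ (θ, x))
    (s := Icc (-1 / 2 : ℝ) (1 / 2)) (bound := fun _ => C) (Icc_mem_nhds (by norm_num) (by norm_num))
    ?_ (intervalIntegrable_slopeKernel ha hb hσ h0).1
    ((intervalIntegrable_slopeKernel ha hb hσ h0).2.def'.aestronglyMeasurable)
    (ae_of_all _ fun x hx θ hθ => ?_) intervalIntegrable_const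
    (ae_of_all _ fun x hx θ hθ => ?_)).2
  · filter_upwards [Icc_mem_nhds (show (-1 / 2 : ℝ) < 0 by norm_num)
      (show (0 : ℝ) < 1 / 2 by norm_num)] with θ hθ
    exact (intervalIntegrable_slopeKernel ha hb hσ hθ).1.def'.aestronglyMeasurable
  · rw [uIoc_of_le zero_le_one] at hx
    exact hC (θ, x) ⟨hθ, Ioc_subset_Icc_self hx⟩
  · rw [uIoc_of_le zero_le_one] at hx
    exact hasDerivAt_slopeKernel ha hb hσ hθ (Ioc_subset_Icc_self hx)

lemma ratioKernel_eq_slopeKernel (ha : 0 < a) (hb : 0 < b) (hσ : σ ^ 2 = 1) {θ x : ℝ}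
    (hθ : θ ∈ Icc (-1 / 2 : ℝ) (1 / 2)) (hx : x ∈ Icc (0 : ℝ) 1) :
    ratioKernel a b θ (σ * θ) 0 x = slopeKernel a b σ (θ, x) := by
  have hq := slope_quadratic_pos hσ hθ x
  have hN := slope_ratioNum_pos ha hb hθ hx
  have hpow : ∀ y : ℝ, 0 < y → y ^ (-(3 / 2) : ℝ) = (y * Real.sqrt y)⁻¹ := fun y hy => by
    rw [Real.rpow_neg hy.le, show (3 / 2 : ℝ) = 1 + 1 / 2 by norm_num, Real.rpow_add hy,
      Real.rpow_one, Real.sqrt_eq_rpow]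
  have hpow' : ∀ y : ℝ, 0 < y → y ^ (-(1 / 2) : ℝ) = (Real.sqrt y)⁻¹ := fun y hy => by
    rw [Real.rpow_neg hy.le, Real.sqrt_eq_rpow]
  simp only [slopeKernel, ratioKernel, ratioDen]
  rw [hpow _ hq, hpow' _ hN]
  generalize x ^ 2 + 2 * (σ * θ) * x + 1 = q at *
  generalize ratioNum a b θ x = N at *
  have h1 : 0 < Real.sqrt q := by positivity
  have h2 : 0 < Real.sqrt N := by positivity
  have : q * N + 0 ^ 2 * (1 - θ ^ 2) * x ^ 2 = q * N := by ring
  rw [this, Real.sqrt_mul hq.le]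
  field_simp

/-- The prefactor 1 - θ² has derivative 0 at 0. The derivatives of the quadratic factor for σ = 1
and σ = -1 cancel, so only those of `ratioNum` remain, and they are equal. -/
lemma hasDerivAt_halfDensity (ha : 0 < a) (hb : 0 < b) :
    HasDerivAt (fun θ => halfDensity a b θ 0) (slopeIntegral a b) 0 := by
  have h0 : (0 : ℝ) ∈ Icc (-1 / 2 : ℝ) (1 / 2) := by norm_num
  have s1 : (1 : ℝ) ^ 2 = 1 := one_pow 2
  have s2 : (-1 : ℝ) ^ 2 = 1 := by norm_num
  have hd : HasDerivAt (fun θ : ℝ => (1 - θ ^ 2) / (2 * Real.pi)) 0 0 := by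
    have h := ((hasDerivAt_pow 2 (0 : ℝ)).const_sub 1).div_const (2 * Real.pi)
    simpa using h
  have h := hd.mul ((hasDerivAt_integral_slopeKernel ha hb s1).add
    (hasDerivAt_integral_slopeKernel ha hb s2))
  have heq : (fun θ => halfDensity a b θ 0) =ᶠ[𝓝 0]
      (fun θ : ℝ => (1 - θ ^ 2) / (2 * Real.pi)) *
      ((fun θ => ∫ x in (0 : ℝ)..1, slopeKernel a b 1 (θ, x)) +
        fun θ => ∫ x in (0 : ℝ)..1, slopeKernel a b (-1) (θ, x)) := by
    filter_upwards [Icc_mem_nhds (show (-1 / 2 : ℝ) < 0 by norm_num)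
      (show (0 : ℝ) < 1 / 2 by norm_num)] with θ hθ
    simp only [Pi.mul_apply, Pi.add_apply]
    rw [halfDensity, ← intervalIntegral.integral_add (intervalIntegrable_slopeKernel ha hb s1 hθ).1
      (intervalIntegrable_slopeKernel ha hb s2 hθ).1]
    congr 1
    refine intervalIntegral.integral_congr fun x hx => ?_
    rw [uIcc_of_le zero_le_one] at hx
    have e1 := ratioKernel_eq_slopeKernel ha hb s1 hθ hx
    have e2 := ratioKernel_eq_slopeKernel ha hb s2 hθ hx
    rw [one_mul] at e1
    rw [neg_one_mul] at e2
    simp only [e1, e2]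
  refine (h.congr_of_eventuallyEq heq).congr_deriv ?_
  rw [zero_mul, zero_add, ← intervalIntegral.integral_add
    (intervalIntegrable_slopeKernel ha hb s1 h0).2 (intervalIntegrable_slopeKernel ha hb s2 h0).2,
    ← intervalIntegral.integral_const_mul, slopeIntegral]
  refine intervalIntegral.integral_congr fun x hx => ?_
  have hq : 0 < x ^ 2 + 1 := by positivity
  have hN : 0 < a ^ 2 + b ^ 2 * x ^ 2 := by positivity
  have e : ratioNum a b 0 x = a ^ 2 + b ^ 2 * x ^ 2 := by simp [ratioNum]
  simp only [slopeKernelDeriv, e, mul_zero, zero_mul, add_zero]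
  rw [show (-(1 / 2) - 1 : ℝ) = -(3 / 2) by norm_num, Real.rpow_neg hN.le (3 / 2),
    Real.rpow_neg hq.le (3 / 2)]
  have hq' : 0 < (x ^ 2 + 1) ^ (3 / 2 : ℝ) := by positivity
  have hN' : 0 < (a ^ 2 + b ^ 2 * x ^ 2) ^ (3 / 2 : ℝ) := by positivity
  have hpi := Real.pi_pos
  field_simp
  ring

lemma slopeIntegral_pos (ha : 0 < a) (hb : 0 < b) : 0 < slopeIntegral a b := by
  refine intervalIntegral.intervalIntegral_pos_of_pos_on ?_ (fun x hx => ?_) one_pos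
  · refine Continuous.intervalIntegrable ?_ _ _
    have h1 : Continuous fun x : ℝ => (a ^ 2 + b ^ 2 * x ^ 2) ^ (3 / 2 : ℝ) :=
      Continuous.rpow_const (by fun_prop) fun x => Or.inr (by norm_num)
    have h2 : Continuous fun x : ℝ => (x ^ 2 + 1) ^ (3 / 2 : ℝ) :=
      Continuous.rpow_const (by fun_prop) fun x => Or.inr (by norm_num)
    refine Continuous.div (by fun_prop) (by fun_prop) fun x => ?_
    positivity
  · have := hx.1
    positivity

end Slope

/-! ### Exclusion of Cauchy laws -/

/-- Equal measures give densities equal almost everywhere; continuity of both upgrades this to every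
point, in particular 0. -/
lemma mixDensity_eq_cauchyPDFReal {a b θ : ℝ} (ha : 0 ≤ a) (hb : 0 ≤ b) (hab : 0 < a + b)
    (hθ : θ ∈ Ioo (-1 : ℝ) 1) {σ : ℝ≥0} (hσ : 0 < σ)
    (h : volume.withDensity (fun v => ENNReal.ofReal (mixDensity a b θ v)) = cauchyMeasure 0 σ) :
    mixDensity a b θ = cauchyPDFReal 0 σ := by
  rw [cauchyMeasure_of_scale_ne_zero 0 hσ.ne', withDensity_eq_iff_of_sigmaFinite
    (measurable_mixDensity a b θ).ennreal_ofReal.aemeasurable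
    (measurable_cauchyPDF 0 σ).aemeasurable] at h
  have hae : mixDensity a b θ =ᵐ[volume] cauchyPDFReal 0 σ := by
    filter_upwards [h] with v hv
    exact (ENNReal.ofReal_eq_ofReal_iff (mixDensity_nonneg a b θ v)
      (cauchyPDF_pos 0 hσ.ne' v).le).1 hv
  refine (continuous_mixDensity ha hb hab hθ).ae_eq_iff_eq volume ?_ |>.1 hae
  unfold cauchyPDFReal
  have hσ' : (0 : ℝ) < σ := hσ
  refine continuous_const.mul (Continuous.inv₀ (by fun_prop) fun v => ?_)
  positivity

lemma tendsto_sq_mul_cauchyPDFReal (σ : ℝ≥0) :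
    Tendsto (fun v : ℝ => v ^ 2 * cauchyPDFReal 0 σ v) atTop (𝓝 (σ / Real.pi)) := by
  have h1 : Tendsto (fun v : ℝ => (σ : ℝ) ^ 2 / v ^ 2) atTop (𝓝 0) :=
    tendsto_const_nhds.div_atTop (tendsto_pow_atTop two_ne_zero)
  have h2 := ((h1.const_add 1).inv₀ (by norm_num)).const_mul ((σ : ℝ) / Real.pi)
  rw [add_zero, inv_one, mul_one] at h2
  refine h2.congr' ?_
  filter_upwards [eventually_gt_atTop 0] with v hv
  rw [cauchyPDFReal, sub_zero]
  have : 0 < v ^ 2 + (σ : ℝ) ^ 2 := by positivity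
  have := Real.pi_pos
  field_simp

/-- Comparing the tail constants 1/π and σ/π forces σ = 1, and the standard Cauchy density takes the
value 1/π at 0. -/
lemma mixDensity_zero_of_cauchy {a b θ : ℝ} (ha : 0 ≤ a) (hb : 0 ≤ b) (hab : a + b = 1)
    (hθ : θ ∈ Ioo (-1 : ℝ) 1) {σ : ℝ≥0} (hσ : 0 < σ)
    (h : volume.withDensity (fun v => ENNReal.ofReal (mixDensity a b θ v)) = cauchyMeasure 0 σ) :
    mixDensity a b θ 0 = 1 / Real.pi := by
  have heq := mixDensity_eq_cauchyPDFReal ha hb (by linarith) hθ hσ h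
  have h1 := tendsto_sq_mul_mixDensity ha hb (by linarith) hθ
  rw [hab, heq] at h1
  have h2 := tendsto_nhds_unique h1 (tendsto_sq_mul_cauchyPDFReal σ)
  have hσ1 : (σ : ℝ) = 1 := by
    have := Real.pi_pos
    field_simp at h2
    exact h2.symm
  rw [heq, cauchyPDFReal, hσ1]
  norm_num

lemma hasDerivAt_mixDensity_zero {a b : ℝ} (ha : 0 < a) (hb : 0 < b) :
    HasDerivAt (fun θ => mixDensity a b θ 0) (slopeIntegral a b + slopeIntegral b a) 0 := by
  refine ((hasDerivAt_halfDensity ha hb).add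
    (hasDerivAt_halfDensity hb ha)).congr_of_eventuallyEq ?_
  filter_upwards [Ioo_mem_nhds (show (-1 : ℝ) < 0 by norm_num) (show (0 : ℝ) < 1 by norm_num)]
    with θ hθ
  exact mixDensity_eq ha.le hb.le (by linarith) hθ 0

/-- A function with nonzero derivative at a point avoids any given value, here the one it takes
there, on a punctured neighbourhood. -/
lemma exists_mixDensity_zero_ne {a b : ℝ} (ha : 0 < a) (hb : 0 < b) (hab : a + b = 1) :
    ∃ ε ∈ Ioc (0 : ℝ) 1, ∀ θ : ℝ, θ ≠ 0 → |θ| < ε → mixDensity a b θ 0 ≠ 1 / Real.pi := by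
  have hpos : 0 < slopeIntegral a b + slopeIntegral b a :=
    add_pos (slopeIntegral_pos ha hb) (slopeIntegral_pos hb ha)
  have h0 : mixDensity a b 0 0 = 1 / Real.pi := by
    rw [mixDensity_eq ha.le hb.le (by linarith) (by norm_num), halfDensity_add_zero ha hb hab]
  have hne := (hasDerivAt_mixDensity_zero ha hb).eventually_ne hpos.ne' (c := 1 / Real.pi)
  rw [eventually_nhdsWithin_iff, Metric.eventually_nhds_iff] at hne
  obtain ⟨δ, hδ, h⟩ := hne
  refine ⟨min δ 1, ⟨lt_min hδ one_pos, min_le_right _ _⟩, fun θ hθ hlt => h ?_ hθ⟩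
  rw [Real.dist_eq, sub_zero]
  exact hlt.trans_le (min_le_left _ _)

end StoppedBrownian

theorem mainTheorem2 :
    (∀ w₁ ∈ Icc (0 : ℝ) 1, ∀ θ ∈ Ioo (-1 : ℝ) 1,
      (∀ (Ω : Type u) [MeasurableSpace Ω] (P : Measure Ω) [IsProbabilityMeasure P]
        (X : ℝ≥0 → Ω → (Fin 2 → ℝ)) (Y : Ω → (Fin 2 → ℝ)),
        StoppedBrownian.IsModel θ X Y P →
          HasLaw (StoppedBrownian.stoppedSum ![w₁, 1 - w₁] X Y)
            (volume.withDensity fun v =>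
              ENNReal.ofReal (StoppedBrownian.mixDensity w₁ (1 - w₁) θ v)) P) ∧
      Tendsto (fun v : ℝ => v ^ 2 * StoppedBrownian.mixDensity w₁ (1 - w₁) θ v) atTop
        (𝓝 (1 / Real.pi))) ∧
    (∀ w₁ ∈ Ioo (0 : ℝ) 1,
      HasDerivAt (fun θ : ℝ => StoppedBrownian.mixDensity w₁ (1 - w₁) θ 0)
        (StoppedBrownian.slopeIntegral w₁ (1 - w₁) + StoppedBrownian.slopeIntegral (1 - w₁) w₁) 0 ∧
      0 < StoppedBrownian.slopeIntegral w₁ (1 - w₁) + StoppedBrownian.slopeIntegral (1 - w₁) w₁ ∧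
      ∃ ε ∈ Ioc (0 : ℝ) 1, ∀ θ : ℝ, θ ≠ 0 → |θ| < ε →
        ∀ (Ω : Type u) [MeasurableSpace Ω] (P : Measure Ω) [IsProbabilityMeasure P]
          (X : ℝ≥0 → Ω → (Fin 2 → ℝ)) (Y : Ω → (Fin 2 → ℝ)),
          StoppedBrownian.IsModel θ X Y P →
            ∀ σ : ℝ≥0, 0 < σ →
              ¬ HasLaw (StoppedBrownian.stoppedSum ![w₁, 1 - w₁] X Y) (cauchyMeasure 0 σ) P) := by
  refine ⟨fun w₁ hw θ hθ => ⟨fun Ω _ P _ X Y hM => ?_, ?_⟩, fun w₁ hw => ?_⟩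
  · exact hM.hasLaw_stoppedSum hθ hw.1 (sub_nonneg.2 hw.2) (by linarith)
  · have h := StoppedBrownian.tendsto_sq_mul_mixDensity hw.1 (sub_nonneg.2 hw.2) (by linarith) hθ
    rwa [add_sub_cancel] at h
  · have ha := hw.1
    have hb : 0 < 1 - w₁ := sub_pos.2 hw.2
    have hab : w₁ + (1 - w₁) = 1 := add_sub_cancel _ _
    refine ⟨StoppedBrownian.hasDerivAt_mixDensity_zero ha hb,
      add_pos (StoppedBrownian.slopeIntegral_pos ha hb) (StoppedBrownian.slopeIntegral_pos hb ha),
      ?_⟩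
    obtain ⟨ε, hε, h⟩ := StoppedBrownian.exists_mixDensity_zero_ne ha hb hab
    refine ⟨ε, hε, fun θ hθ hlt Ω _ P _ X Y hM σ hσ hlaw => h θ hθ hlt ?_⟩
    have hθ' : θ ∈ Ioo (-1 : ℝ) 1 := abs_lt.1 (hlt.trans_le hε.2)
    refine StoppedBrownian.mixDensity_zero_of_cauchy ha.le hb.le hab hθ' hσ ?_
    rw [← (hM.hasLaw_stoppedSum hθ' ha.le hb.le (by linarith)).map_eq, hlaw.map_eq]
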